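/- **Setting.** Let $p\ge 1$, let $\mathcal U\subset\mathbb R^p$ be a compact convex set with piecewise $C^1$ boundary, and let $\mu$ be a probability measure with support $\mathcal U$ that is absolutely continuous with respect to Lebesgue measure. For compact $K'\subset\mathbb R^p$, $C^k(K';\mathbb R^s)$ is the set of functions on $K'$ that are continuous on $K'$, $k$ times continuously differentiable on $\mathrm{Int}(K')$, and whose derivatives up to order $k$ extend continuously to $K'$. A set has piecewise $C^k$ boundary if its boundary is covered by finitely many regular $C^k$ hypersurfaces. **Model.** Random variables $(Y_0,Y_1,D,Z,U_0,U_1)$ on a probability space, with $Y_d,U_d$ in $\mathbb R^p$ and $D,Z\in\{0,1\}$, satisfy the *IV multivariate quantile model* with structural function $q=(q_0,q_1)$ if, almost surely: (A1) for each $d$, $U_d\sim\mu$ and $Y_d=q_d(U_d)$, where $q_d:\mathcal U\to\mathbb R^p$ is continuously differentiable and $Dq_d$ is symmetric and positive definite on $\mathrm{Int}(\mathcal U)$; (A2) each $U_d$ is independent of $Z$; (A3) $D=\delta(Z,\nu)$ for some measurable function $\delta$ and random element $\nu$; (A4) conditionally on $(Z,\nu)$, $U_0$ and $U_1$ are identically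 distributed. The observed variables are $(Y,D,Z)$ with $Y:=Y_D$. **Parameter space.** Let $\mathcal Q=C^2(\mathcal U;\mathbb R^p)^2$ with $\|q\|_{\mathcal Q}=\max_{d}\max_{1\le i\le p}\sup_{u\in\mathcal U}|q_d^i(u)|$. Fix $\overline\lambda>\underline\lambda>0$ and $K>0$. Let $\tilde{\mathcal Q}$ be the set of $q\in\mathcal Q$ such that for $d=0,1$ and all $u\in\mathcal U$, $Dq_d(u)$ is symmetric and positive definite with all eigenvalues in $(\underline\lambda,\overline\lambda)$. For a structural function $q^\ast$ let $$\mathcal Q_0=\Big\{q^\ast+\alpha h\in\tilde{\mathcal Q}\ \Big|\ \alpha\ge 0,\ h\in\mathcal Q,\ \|h\|_{\mathcal Q}=1,\ \max_{d}\sup_{u\in\mathcal U}\|Dh_d(u)\|_{\mathrm{op}}\le K\Big\}.$$ **Local identification.** $q^\ast\in\mathcal Q_0$ is *locally identified in $\mathcal Q_0$* if there is $\varepsilon>0$ such that, whenever $(\tilde Y_0,\tilde Y_1,\tilde D,\tilde Z,\tilde U_0,\tilde U_1)$, on any probability space, satisfies the model (with the same $\mathcal U,\mu$) with some $q\in\mathcal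 Q_0$, $q\ne q^\ast$, $\|q-q^\ast\|_{\mathcal Q}<\varepsilon$, the joint distribution of $(\tilde Y_{\tilde D},\tilde D,\tilde Z)$ differs from that of $(Y,D,Z)$. **Theorem 3.1.** Suppose $(Y_0,Y_1,D,Z,U_0,U_1)$ satisfies the model with structural function $q^\ast$, that $\mathbb P(Z=z)>0$ for $z\in\{0,1\}$, and that 1. $q^\ast\in\mathcal Q_0$ (correct specification); 2. for each $d$, the support $\mathcal Y_d$ of the distribution of $Y_d$ is a convex compact set with piecewise $C^2$ boundary; 3. for all $d,z\in\{0,1\}$, the measure $B\mapsto\mathbb P(Y\in B,\,D=d\mid Z=z)$ has a density $f_{d,z}$ on $\mathcal Y_d$ with $f_{d,z}\in C^1(\mathcal Y_d;\mathbb R)$. If $$4f_{0,0}(y_0)f_{1,1}(y_1)>\left(\frac{\overline\lambda}{\underline\lambda}\right)^{p+1}\big(f_{0,1}(y_0)+f_{1,0}(y_1)\big)^2$$ for Lebesgue-almost all $(y_0,y_1)\in\mathcal Y_0\times\mathcal Y_1$, then $q^\ast$ is locally identified in $\mathcal Q_0$. -/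

import Mathlib

open MeasureTheory ProbabilityTheory

universe u v

namespace IVQ

/-- Euclidean space `ℝ^p`. -/
abbrev Euc (p : ℕ) : Type := EuclideanSpace ℝ (Fin p)

/-- `S` has a piecewise `C^k` boundary: the boundary is contained in the union of finitely many
regular `C^k` hypersurfaces `{x ∈ W i | ρ i x = 0}`, where `ρ i` is `C^k` on the open set `W i`
and its gradient does not vanish on its zero set. Edges and corners, where several pieces
meet, are allowed. -/
def HasPiecewiseBoundary {E : Type*} [NormedAddCommGroup E] [NormedSpace ℝ E]
    (k : ℕ) (S : Set E) : Prop :=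
  ∃ (N : ℕ) (W : Fin N → Set E) (ρ : Fin N → E → ℝ),
    (∀ i, IsOpen (W i) ∧ ContDiffOn ℝ k (ρ i) (W i) ∧
      ∀ x ∈ W i, ρ i x = 0 → fderiv ℝ (ρ i) x ≠ 0) ∧
    frontier S ⊆ ⋃ i, {x | x ∈ W i ∧ ρ i x = 0}

/-- The class `C^k(K; F)`: functions which are continuous on `K`, `k` times continuously
differentiable on the interior of `K`, and whose derivatives up to order `k` extend continuously
to `K`. Only the values of `f` on `K` matter. -/
def IsCk {E F : Type*} [NormedAddCommGroup E] [NormedSpace ℝ E]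
    [NormedAddCommGroup F] [NormedSpace ℝ F] (k : ℕ) (K : Set E) (f : E → F) : Prop :=
  ContinuousOn f K ∧ ContDiffOn ℝ k f (interior K) ∧
    ∀ j : ℕ, j ≤ k → ∃ g : E → E [×j]→L[ℝ] F,
      ContinuousOn g K ∧ Set.EqOn g (iteratedFDeriv ℝ j f) (interior K)

/-- The derivative `Df` of a function in `C^1(K; F)` as a function on all of `K`: the usual
derivative on the interior, extended by continuity to `K`. -/
noncomputable def derivOn {E F : Type*} [NormedAddCommGroup E] [NormedSpace ℝ E]
    [NormedAddCommGroup F] [NormedSpace ℝ F] (K : Set E) (f : E → F) : E → E →L[ℝ] F :=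
  extendFrom (interior K) (fderiv ℝ f)

/-- Symmetric and positive definite linear maps of `ℝ^p`. -/
def IsSymPosDef {p : ℕ} (A : Euc p →L[ℝ] Euc p) : Prop :=
  (∀ x y, inner ℝ (A x) y = inner ℝ x (A y)) ∧ ∀ x, x ≠ 0 → 0 < inner ℝ (A x) x

/-- A pair of candidate structural functions `(q_0, q_1)`; only the values on the set `𝒰` of
ranks are ever used. -/
abbrev Struct (p : ℕ) : Type := Fin 2 → Euc p → Euc p

/-- `‖q‖_𝒬 = max_d max_i sup_{u ∈ 𝒰} |q_d^i(u)|`. -/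
noncomputable def normQ {p : ℕ} (𝒰 : Set (Euc p)) (q : Struct p) : ℝ :=
  ⨆ d : Fin 2, ⨆ i : Fin p, ⨆ u : 𝒰, |q d u i|

/-- `‖M‖_∞ = sup_{u ∈ 𝒰} sup_{‖v‖ = 1} ‖M(u) v‖`, for the Euclidean norm. -/
noncomputable def supOpNorm {p : ℕ} (𝒰 : Set (Euc p)) (M : Euc p → Euc p →L[ℝ] Euc p) : ℝ :=
  ⨆ u : 𝒰, ‖M u‖

/-- The space `𝒬 = C²(𝒰; ℝ^p)²`. -/
def spaceQ {p : ℕ} (𝒰 : Set (Euc p)) : Set (Struct p) :=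
  {q | ∀ d, IsCk 2 𝒰 (q d)}

/-- The set of `q ∈ 𝒬` such that each `Dq_d` is symmetric and positive definite on `𝒰`, with all
its eigenvalues strictly between `lo` and `hi`. -/
def tildeQ {p : ℕ} (𝒰 : Set (Euc p)) (lo hi : ℝ) : Set (Struct p) :=
  {q | q ∈ spaceQ 𝒰 ∧ ∀ d, ∀ u ∈ 𝒰,
    IsSymPosDef (derivOn 𝒰 (q d) u) ∧
    ∀ l : ℝ, Module.End.HasEigenvalue (derivOn 𝒰 (q d) u : Euc p →ₗ[ℝ] Euc p) l →
      lo < l ∧ l < hi}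

/-- The parameter set `𝒬₀`: the `q` in `tildeQ` of the form `q* + α h` (on `𝒰`) with `α ≥ 0`,
`h ∈ 𝒬`, `‖h‖_𝒬 = 1` and `max_d ‖Dh_d‖_∞ ≤ K`. -/
def Q0 {p : ℕ} (𝒰 : Set (Euc p)) (lo hi K : ℝ) (qstar : Struct p) : Set (Struct p) :=
  {q | q ∈ tildeQ 𝒰 lo hi ∧ ∃ (α : ℝ) (h : Struct p), 0 ≤ α ∧ h ∈ spaceQ 𝒰 ∧
    normQ 𝒰 h = 1 ∧ (∀ d, supOpNorm 𝒰 (derivOn 𝒰 (h d)) ≤ K) ∧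
    ∀ d, ∀ u ∈ 𝒰, q d u = qstar d u + α • h d u}

/-- The observed outcome `Y = Y_D`. -/
def obsY {p : ℕ} {Ω : Type*} (Y : Fin 2 → Ω → Euc p) (D : Ω → Fin 2) : Ω → Euc p :=
  fun ω => Y (D ω) ω

/-- The joint distribution of the observed variables `(Y, D, Z)`. -/
noncomputable def obsLaw {p : ℕ} {Ω : Type*} [MeasurableSpace Ω] (P : Measure Ω)
    (Y : Fin 2 → Ω → Euc p) (D Z : Ω → Fin 2) : Measure (Euc p × Fin 2 × Fin 2) :=
  P.map (fun ω => (obsY Y D ω, D ω, Z ω))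

/-- The IV multivariate quantile model with binary treatment `D` and binary instrument `Z`:
`((Y_d), D, Z, (U_d))` are random variables on `(Ω, P)` which satisfy the model with structural
function `q` and reference measure `μ` on `𝒰`. -/
structure Model {p : ℕ} (𝒰 : Set (Euc p)) (μ : Measure (Euc p)) (q : Struct p)
    {Ω : Type u} [MeasurableSpace Ω] (P : Measure Ω)
    (Y : Fin 2 → Ω → Euc p) (D Z : Ω → Fin 2) (U : Fin 2 → Ω → Euc p) : Prop where
  measurable_Y : ∀ d, Measurable (Y d)
  measurable_D : Measurable D
  measurable_Z : Measurable Z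
  measurable_U : ∀ d, Measurable (U d)
  /-- The ranks have the reference distribution. -/
  law_U : ∀ d, P.map (U d) = μ
  /-- Potential outcomes are given by the structural function. -/
  outcome : ∀ d, ∀ᵐ ω ∂P, Y d ω = q d (U d ω)
  /-- The structural function is continuously differentiable. -/
  smooth : ∀ d, IsCk 1 𝒰 (q d)
  /-- Its derivative is symmetric and positive definite. -/
  deriv_pos : ∀ d, ∀ u ∈ interior 𝒰, IsSymPosDef (fderiv ℝ (q d) u)
  /-- Each rank variable is independent of the instrument. -/
  indep : ∀ d, IndepFun (U d) Z P
  /-- The treatment is `D = δ(Z, ν)` for some random element `ν`, and the rank variables `U_d`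
  are identically distributed conditionally on `(Z, ν)` (rank similarity). -/
  assignment : ∃ (V : Type u) (_ : MeasurableSpace V) (ν : Ω → V) (δ : Fin 2 × V → Fin 2),
    Measurable ν ∧ Measurable δ ∧ (∀ᵐ ω ∂P, D ω = δ (Z ω, ν ω)) ∧
    ∀ d d' : Fin 2, ∀ B : Set (Euc p), MeasurableSet B →
      P⟦U d ⁻¹' B | MeasurableSpace.comap (fun ω => (Z ω, ν ω)) inferInstance⟧
        =ᵐ[P] P⟦U d' ⁻¹' B | MeasurableSpace.comap (fun ω => (Z ω, ν ω)) inferInstance⟧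

/-- The support `𝒴_d` of the distribution of the potential outcome `Y_d`. -/
noncomputable def suppY {p : ℕ} {Ω : Type*} [MeasurableSpace Ω] (P : Measure Ω)
    (Y : Fin 2 → Ω → Euc p) (d : Fin 2) : Set (Euc p) :=
  (P.map (Y d)).support

/-- `g` is, on `𝒴_d`, the density `f_{d,z}` of the measure `B ↦ ℙ(Y ∈ B, D = d | Z = z)`. -/
def IsDensity {p : ℕ} {Ω : Type*} [MeasurableSpace Ω] (P : Measure Ω)
    (Y : Fin 2 → Ω → Euc p) (D Z : Ω → Fin 2) (d z : Fin 2) (g : Euc p → ℝ) : Prop :=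
  (∀ y ∈ suppY P Y d, 0 ≤ g y) ∧
  ∀ B : Set (Euc p), MeasurableSet B →
    P[|Z ⁻¹' {z}] (obsY Y D ⁻¹' B ∩ D ⁻¹' {d}) =
      ∫⁻ y in B ∩ suppY P Y d, ENNReal.ofReal (g y)

/-- `q*` is identified in `S` from the observed law `L`: no model with a structural function
`q ∈ S` that differs from `q*` (on `𝒰`) generates the observed law `L`. -/
def IsIdentifiedIn {p : ℕ} (𝒰 : Set (Euc p)) (μ : Measure (Euc p))
    (L : Measure (Euc p × Fin 2 × Fin 2)) (qstar : Struct p) (S : Set (Struct p)) : Prop :=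
  ∀ (Ω : Type v) [MeasurableSpace Ω] (P : Measure Ω) [IsProbabilityMeasure P]
    (Y : Fin 2 → Ω → Euc p) (D Z : Ω → Fin 2) (U : Fin 2 → Ω → Euc p) (q : Struct p),
    q ∈ S → ¬ (∀ d, Set.EqOn (q d) (qstar d) 𝒰) → Model 𝒰 μ q P Y D Z U →
    obsLaw P Y D Z ≠ L

/-- `q*` is locally identified in `S`: it is identified in `{q ∈ S | ‖q - q*‖_𝒬 < ε}` for some
`ε > 0`. -/
def IsLocallyIdentifiedIn {p : ℕ} (𝒰 : Set (Euc p)) (μ : Measure (Euc p))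
    (L : Measure (Euc p × Fin 2 × Fin 2)) (qstar : Struct p) (S : Set (Struct p)) : Prop :=
  ∃ ε : ℝ, 0 < ε ∧
    IsIdentifiedIn.{v} 𝒰 μ L qstar {q | q ∈ S ∧ normQ 𝒰 (q - qstar) < ε}

end IVQ

/-! Suppose a rival structure `q = q* + α h` generates the same observed law. Since `Y = q*_d(U_d)`
on `D = d`, equality of the laws turns each rank law (the law of `U_d` on `D = d`, given `Z = z`)
into its push-forward under the transport `T_d = q_d⁻¹ ∘ q*_d`. Rank similarity and independence
from `Z` make the two rank laws for a given `z` add up to `μ` in both models. So, with `a_{d,z}` the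
rank densities of the true model, `Σ_d ∫ (φ(u) - φ(T_d u)) a_{d,z}(u) du = 0` for each `z` and every
continuous `φ`.

The test function is chosen according to `z`. As `Dq` and `Dq*` are symmetric, so is `Dh_z`, and on
the convex set `𝒰` the field `h_z` has a potential `ψ_z`; take `φ = ψ_z`. With `w_d = (u - T_d u)/α`
and `A_d = Dq*_d(u)`, a first-order expansion gives `h_d(u) ≈ A_d w_d` and `ψ_z(u) - ψ_z(T_d u) ≈ α
⟨A_z w_z, w_d⟩`. Summed over `z`, the restrictions say that `∫ Σ a_{d,z} ⟨A_z w_z, w_d⟩` is small.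

The correlation condition makes this quadratic form coercive. Cauchy-Schwarz for the form `A_d`
controls the cross terms at the cost of one factor `hi / lo`; the Jacobians in `a_{d,z} =
f_{d,z}(q*_d) |det A_d|` cost `(hi / lo) ^ p`. Hence the exponent `p + 1`. The condition holds only
almost everywhere, so a uniform margin comes instead from compactness: the spectra of `Dq*_d` stay
above some `lo' > lo`.

Finally `h` has sup norm one and Lipschitz constant `K`, so it stays large on a ball of fixed
radius, and the coercive integral is bounded below uniformly in `h`. For small `α` this contradicts
the restrictions. The main lemmas are `Model.sum_integral_eq_zero`, `quadratic_lower_bound`,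
`weighted_sum_bound` and `exists_perturbation_radius`. -/

namespace IVQ

open Set Filter Topology

/-! ### Calculus on convex sets, up to the boundary -/

section Analysis

theorem exists_modulus {E F : Type*} [SeminormedAddCommGroup E]
    [SeminormedAddCommGroup F] {K : Set E} (hK : IsCompact K) {A : E → F} (hA : ContinuousOn A K)
    {η : ℝ} (hη : 0 < η) :
    ∃ r > 0, ∀ x ∈ K, ∀ y ∈ K, ‖x - y‖ ≤ r → ‖A x - A y‖ ≤ η := by
  have := Metric.uniformContinuousOn_iff.1 (hK.uniformContinuousOn_of_continuous hA) η hη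
  obtain ⟨δ, hδ, h⟩ := this
  refine ⟨δ / 2, by positivity, fun x hx y hy hxy => ?_⟩
  rw [← dist_eq_norm] at hxy ⊢
  exact (h x hx y hy (by linarith)).le

variable {E F : Type*} [NormedAddCommGroup E] [NormedSpace ℝ E]
  [NormedAddCommGroup F] [NormedSpace ℝ F]

theorem subset_closure_interior {K : Set E} (hconv : Convex ℝ K) (hInt : (interior K).Nonempty) :
    K ⊆ closure (interior K) := by
  rw [hconv.closure_interior_eq_closure_of_nonempty_interior hInt]
  exact subset_closure

theorem IsCk.exists_tendsto_fderiv {K : Set E} {f : E → F} {k : ℕ} (hf : IsCk k K f) (hk : 1 ≤ k)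
    {x : E} (hx : x ∈ K) : ∃ A, Tendsto (fderiv ℝ f) (𝓝[interior K] x) (𝓝 A) := by
  obtain ⟨g, hg, hgf⟩ := hf.2.2 1 hk
  refine ⟨continuousMultilinearCurryFin1 ℝ E F (g x), ?_⟩
  have h1 : Tendsto (fun y => continuousMultilinearCurryFin1 ℝ E F (g y)) (𝓝[interior K] x)
      (𝓝 (continuousMultilinearCurryFin1 ℝ E F (g x))) :=
    ((continuousMultilinearCurryFin1 ℝ E F).continuous.tendsto _).comp
      ((hg x hx).mono_left (nhdsWithin_mono _ interior_subset))
  refine h1.congr' ?_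
  filter_upwards [self_mem_nhdsWithin] with y hy
  ext v
  rw [hgf hy]
  simp [iteratedFDeriv_one_apply]

theorem IsCk.continuousOn_derivOn {K : Set E} {f : E → F} {k : ℕ} (hf : IsCk k K f) (hk : 1 ≤ k)
    (hconv : Convex ℝ K) (hInt : (interior K).Nonempty) : ContinuousOn (derivOn K f) K :=
  continuousOn_extendFrom (subset_closure_interior hconv hInt)
    fun _ hx => hf.exists_tendsto_fderiv hk hx

/-- On the convex interior the derivative has a limit at each boundary point, and the mean value
inequality makes that limit a derivative within the closure. -/
theorem IsCk.hasFDerivWithinAt_derivOn {K : Set E} {f : E → F} {k : ℕ} (hf : IsCk k K f)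
    (hk : 1 ≤ k) (hconv : Convex ℝ K) (hclosed : IsClosed K) (hInt : (interior K).Nonempty)
    {x : E} (hx : x ∈ K) : HasFDerivWithinAt f (derivOn K f x) K x := by
  have hcl : closure (interior K) = K := by
    rw [hconv.closure_interior_eq_closure_of_nonempty_interior hInt, hclosed.closure_eq]
  have h := hasFDerivWithinAt_closure_of_tendsto_fderiv (f := f) (s := interior K) (x := x)
    (f' := derivOn K f x)
    ((hf.2.1.differentiableOn (by exact_mod_cast (by omega : k ≠ 0))))
    hconv.interior isOpen_interior
    (fun y hy => (hf.1 y (hcl ▸ hy)).mono interior_subset)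
    (tendsto_extendFrom (hf.exists_tendsto_fderiv hk hx))
  rwa [hcl] at h

/-- A primitive of a differentiable vector field with symmetric derivative on a convex set. -/
theorem exists_potential {p : ℕ} {K : Set (Euc p)} (hK : Convex ℝ K) {h : Euc p → Euc p}
    {A : Euc p → Euc p →L[ℝ] Euc p} (hd : ∀ x ∈ K, HasFDerivWithinAt h (A x) K x)
    (hsymm : ∀ u ∈ K, ∀ x y, inner ℝ (A u x) y = inner ℝ x (A u y)) :
    ∃ ψ : Euc p → ℝ, ∀ x ∈ K, HasFDerivWithinAt ψ (innerSL ℝ (h x)) K x := by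
  -- Poincaré lemma: symmetry of `A` says that the 1-form `⟨h, ·⟩` is closed.
  refine hK.exists_forall_hasFDerivWithinAt_of_hasFDerivWithinAt_symmetric
    (ω := fun x => innerSL ℝ (h x)) (dω := fun x => (innerSL ℝ).comp (A x)) ?_ ?_
  · intro x hx
    exact (innerSL ℝ (E := Euc p)).hasFDerivAt.comp_hasFDerivWithinAt x (hd x hx)
  · intro a ha x _ y _
    simp only [ContinuousLinearMap.comp_apply, innerSL_apply_apply]
    rw [hsymm a ha, real_inner_comm]

theorem abs_potential_sub_le {p : ℕ} {K : Set (Euc p)} (hK : Convex ℝ K) {h : Euc p → Euc p}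
    {ψ : Euc p → ℝ} (hψ : ∀ x ∈ K, HasFDerivWithinAt ψ (innerSL ℝ (h x)) K x) {C : ℝ}
    (hC : 0 ≤ C) (hh : ∀ x ∈ K, ∀ y ∈ K, ‖h x - h y‖ ≤ C * ‖x - y‖) {u v : Euc p}
    (hu : u ∈ K) (hv : v ∈ K) :
    |ψ u - ψ v - inner ℝ (h u) (u - v)| ≤ C * ‖u - v‖ ^ 2 := by
  obtain ⟨z, hz, hz'⟩ := domain_mvt hψ hK hv hu
  have hzK := hK.segment_subset hv hu hz
  rw [hz', innerSL_apply_apply, ← inner_sub_left]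
  refine (abs_real_inner_le_norm _ _).trans ?_
  have : ‖z - u‖ ≤ ‖u - v‖ := by
    rw [segment_symm] at hz
    have := norm_sub_le_of_mem_segment hz
    rwa [norm_sub_rev u v]
  calc ‖h z - h u‖ * ‖u - v‖ ≤ (C * ‖u - v‖) * ‖u - v‖ := by
        gcongr
        exact (hh z hzK u hu).trans (by gcongr)
    _ = _ := by ring

/-- The mean value theorem for the scalar function `x ↦ ⟨u - v, f x⟩` on the segment, followed by
Cauchy-Schwarz. -/
theorem strong_monotone {p : ℕ} {K : Set (Euc p)} (hK : Convex ℝ K) {f : Euc p → Euc p}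
    {A : Euc p → Euc p →L[ℝ] Euc p} (hd : ∀ x ∈ K, HasFDerivWithinAt f (A x) K x) {l : ℝ}
    (hl : ∀ u ∈ K, ∀ x, l * ‖x‖ ^ 2 ≤ inner ℝ (A u x) x) {u v : Euc p}
    (hu : u ∈ K) (hv : v ∈ K) : l * ‖u - v‖ ≤ ‖f u - f v‖ := by
  obtain ⟨z, hz, hz'⟩ := domain_mvt (f := fun x => inner ℝ (u - v) (f x))
    (f' := fun x => (innerSL ℝ (u - v)).comp (A x))
    (fun x hx => (innerSL ℝ (u - v)).hasFDerivAt.comp_hasFDerivWithinAt x (hd x hx)) hK hv hu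
  have h1 := hl z (hK.segment_subset hv hu hz) (u - v)
  rw [← inner_sub_right] at hz'
  simp only [ContinuousLinearMap.comp_apply, innerSL_apply_apply] at hz'
  rw [real_inner_comm, ← hz'] at h1
  have h2 := h1.trans (real_inner_le_norm _ _)
  rcases (norm_nonneg (u - v)).eq_or_lt with h0 | h0
  · rw [← h0]; simp
  · nlinarith

theorem norm_sub_sub_le_of_near {K : Set E} (hK : Convex ℝ K) {f : E → F} {A : E → E →L[ℝ] F}
    (hd : ∀ x ∈ K, HasFDerivWithinAt f (A x) K x) {η r : ℝ}
    (hA : ∀ x ∈ K, ∀ y ∈ K, ‖x - y‖ ≤ r → ‖A x - A y‖ ≤ η) {u v : E} (hu : u ∈ K) (hv : v ∈ K)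
    (huv : ‖u - v‖ ≤ r) : ‖f u - f v - A u (u - v)‖ ≤ η * ‖u - v‖ := by
  have hsub : segment ℝ v u ⊆ K := hK.segment_subset hv hu
  refine (convex_segment v u).norm_image_sub_le_of_norm_hasFDerivWithin_le' (f' := A)
    (fun x hx => (hd x (hsub hx)).mono hsub) (fun x hx => ?_)
    (left_mem_segment ℝ v u) (right_mem_segment ℝ v u)
  refine hA x (hsub hx) u hu ?_
  rw [segment_symm] at hx
  have := norm_sub_le_of_mem_segment hx
  rw [norm_sub_rev u v] at huv
  exact this.trans huv

/-- The interior of a convex body is dense in it, so a relatively open piece contains a nonempty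
open set. -/
theorem measure_inter_pos [MeasurableSpace E] [BorelSpace E] (m : Measure E)
    [m.IsOpenPosMeasure] {K V : Set E} (hconv : Convex ℝ K) (hInt : (interior K).Nonempty)
    (hV : IsOpen V) (hne : (V ∩ K).Nonempty) : 0 < m (V ∩ K) := by
  obtain ⟨x, hxV, hxK⟩ := hne
  have hx := subset_closure_interior hconv hInt hxK
  obtain ⟨y, hyV, hyK⟩ := mem_closure_iff.1 hx V hV hxV
  exact ((hV.inter isOpen_interior).measure_pos m ⟨y, hyV, hyK⟩).trans_le
    (measure_mono (inter_subset_inter_right _ interior_subset))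

/-- A convex set has null frontier, and with empty interior it would lie in its frontier. -/
theorem interior_nonempty_of_measure_pos [MeasurableSpace E] [BorelSpace E]
    [FiniteDimensional ℝ E] (m : Measure E) [m.IsAddHaarMeasure] {K : Set E}
    (hconv : Convex ℝ K) (hpos : m K ≠ 0) : (interior K).Nonempty := by
  by_contra hne
  rw [not_nonempty_iff_eq_empty] at hne
  refine hpos (measure_mono_null ?_ (hconv.addHaar_frontier m))
  rw [frontier, hne, sdiff_empty]
  exact subset_closure

end Analysis

/-! ### Symmetric positive maps: Cauchy-Schwarz, Rayleigh quotients, determinants -/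

section Spectral

variable {p : ℕ} {A : Euc p →L[ℝ] Euc p}

/-- The polynomial `t ↦ ⟨A (x + t y), x + t y⟩` is nonnegative, so its discriminant is not positive.
-/
theorem inner_sq_le_mul (hs : ∀ x y, inner ℝ (A x) y = inner ℝ x (A y))
    (hpos : ∀ x, 0 ≤ inner ℝ (A x) x) (x y : Euc p) :
    (inner ℝ (A x) y) ^ 2 ≤ inner ℝ (A x) x * inner ℝ (A y) y := by
  have h : ∀ t : ℝ, 0 ≤ inner ℝ (A y) y * (t * t) + (2 * inner ℝ (A x) y) * t + inner ℝ (A x) x := by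
    intro t
    have := hpos (x + t • y)
    have h1 : inner ℝ (A y) x = inner ℝ (A x) y := by rw [hs, real_inner_comm]
    simp only [map_add, map_smul, inner_add_left, inner_add_right, inner_smul_left,
      inner_smul_right, h1] at this
    simp at this
    linarith
  have := discrim_le_zero h
  rw [discrim] at this
  nlinarith

theorem norm_apply_le (hs : ∀ x y, inner ℝ (A x) y = inner ℝ x (A y))
    (hpos : ∀ x, 0 ≤ inner ℝ (A x) x) {hi : ℝ} (hhi : ∀ x, inner ℝ (A x) x ≤ hi * ‖x‖ ^ 2)
    (h0 : 0 ≤ hi) (x : Euc p) : ‖A x‖ ≤ hi * ‖x‖ := by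
  have h := inner_sq_le_mul hs hpos x (A x)
  rw [real_inner_self_eq_norm_sq] at h
  have h1 : (‖A x‖ ^ 2) ^ 2 ≤ (hi * ‖x‖ ^ 2) * (hi * ‖A x‖ ^ 2) :=
    h.trans (mul_le_mul (hhi x) (hhi _) (hpos _) (by positivity))
  rcases (norm_nonneg (A x)).eq_or_lt with h2 | h2
  · rw [← h2]; positivity
  · refine le_of_sq_le_sq ?_ (by positivity)
    have h3 : 0 < ‖A x‖ ^ 2 := by positivity
    nlinarith

theorem inner_apply_eq_sum (hs : (A : Euc p →ₗ[ℝ] Euc p).IsSymmetric) (x : Euc p) :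
    inner ℝ (A x) x = ∑ i, hs.eigenvalues finrank_euclideanSpace_fin i *
      ((hs.eigenvectorBasis finrank_euclideanSpace_fin).repr x i) ^ 2 := by
  have h := (hs.eigenvectorBasis finrank_euclideanSpace_fin).repr.inner_map_map (A x) x
  rw [← h, PiLp.inner_apply]
  refine Finset.sum_congr rfl fun i _ => ?_
  have := hs.eigenvectorBasis_apply_self_apply finrank_euclideanSpace_fin x i
  simp only [ContinuousLinearMap.coe_coe] at this
  rw [this]
  simp
  ring

theorem norm_sq_eq_sum (hs : (A : Euc p →ₗ[ℝ] Euc p).IsSymmetric) (x : Euc p) :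
    ‖x‖ ^ 2 = ∑ i, ((hs.eigenvectorBasis finrank_euclideanSpace_fin).repr x i) ^ 2 := by
  rw [← (hs.eigenvectorBasis finrank_euclideanSpace_fin).repr.norm_map x,
    EuclideanSpace.norm_sq_eq]
  simp

theorem inner_apply_bounds (hs : ∀ x y, inner ℝ (A x) y = inner ℝ x (A y)) {lo hi : ℝ}
    (heig : ∀ l, Module.End.HasEigenvalue (A : Euc p →ₗ[ℝ] Euc p) l → lo < l ∧ l < hi)
    (x : Euc p) : inner ℝ (A x) x ≤ hi * ‖x‖ ^ 2 ∧ (x ≠ 0 → lo * ‖x‖ ^ 2 < inner ℝ (A x) x) := by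
  have hS : (A : Euc p →ₗ[ℝ] Euc p).IsSymmetric := hs
  have hl := fun i => heig _ (hS.hasEigenvalue_eigenvalues finrank_euclideanSpace_fin i)
  rw [inner_apply_eq_sum hS, norm_sq_eq_sum hS, Finset.mul_sum, Finset.mul_sum]
  refine ⟨Finset.sum_le_sum fun i _ => mul_le_mul_of_nonneg_right (hl i).2.le (sq_nonneg _),
    fun hx => Finset.sum_lt_sum
      (fun i _ => mul_le_mul_of_nonneg_right (hl i).1.le (sq_nonneg _)) ?_⟩
  by_contra hcon
  push Not at hcon
  refine hx (norm_eq_zero.1 ?_)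
  have h0 : ‖x‖ ^ 2 = 0 := by
    rw [norm_sq_eq_sum hS]
    refine Finset.sum_eq_zero fun i hi => ?_
    by_contra hne
    have hpos := lt_of_le_of_ne (sq_nonneg _) (Ne.symm hne)
    exact absurd (hcon i hi) (not_le.2 (mul_lt_mul_of_pos_right (hl i).1 hpos))
  simpa using h0

/-- The determinant is the product of the eigenvalues, each a Rayleigh quotient at a unit
eigenvector. -/
theorem det_bounds (hs : ∀ x y, inner ℝ (A x) y = inner ℝ x (A y)) {lo hi : ℝ} (h0 : 0 ≤ lo)
    (hlo : ∀ x, lo * ‖x‖ ^ 2 ≤ inner ℝ (A x) x) (hhi : ∀ x, inner ℝ (A x) x ≤ hi * ‖x‖ ^ 2) :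
    lo ^ p ≤ A.det ∧ A.det ≤ hi ^ p := by
  have hS : (A : Euc p →ₗ[ℝ] Euc p).IsSymmetric := hs
  have hdet : A.det = ∏ i, hS.eigenvalues finrank_euclideanSpace_fin i := by
    have := hS.det_eq_prod_eigenvalues finrank_euclideanSpace_fin
    simpa [ContinuousLinearMap.det] using this
  have hval : ∀ i, hS.eigenvalues finrank_euclideanSpace_fin i =
      inner ℝ (A (hS.eigenvectorBasis finrank_euclideanSpace_fin i))
        (hS.eigenvectorBasis finrank_euclideanSpace_fin i) := by
    intro i
    have h1 := hS.apply_eigenvectorBasis finrank_euclideanSpace_fin i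
    simp only [ContinuousLinearMap.coe_coe] at h1
    rw [h1, inner_smul_left, real_inner_self_eq_norm_sq]
    simp
  have hn : ∀ i, ‖hS.eigenvectorBasis finrank_euclideanSpace_fin i‖ = 1 := by simp
  have hb : ∀ i, lo ≤ hS.eigenvalues finrank_euclideanSpace_fin i ∧
      hS.eigenvalues finrank_euclideanSpace_fin i ≤ hi := by
    intro i
    rw [hval]
    have h1 := hlo (hS.eigenvectorBasis finrank_euclideanSpace_fin i)
    have h2 := hhi (hS.eigenvectorBasis finrank_euclideanSpace_fin i)
    rw [hn] at h1 h2
    constructor <;> linarith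
  rw [hdet]
  constructor
  · calc lo ^ p = ∏ _i : Fin p, lo := by simp
      _ ≤ _ := Finset.prod_le_prod (fun _ _ => h0) fun i _ => (hb i).1
  · calc _ ≤ ∏ _i : Fin p, hi := Finset.prod_le_prod (fun i _ => h0.trans (hb i).1)
            fun i _ => (hb i).2
      _ = hi ^ p := by simp

end Spectral

/-- The quadratic form attains its minimum on `K` times the unit sphere, which turns the strict
pointwise bound into a gap. This gap is the source of the factor `κ < 1` in the main theorem. -/
theorem exists_uniform_lower_bound {p : ℕ} {K : Set (Euc p)} (hK : IsCompact K)
    {A : Euc p → Euc p →L[ℝ] Euc p} (hA : ContinuousOn A K) {lo : ℝ}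
    (hlo : ∀ u ∈ K, ∀ x, x ≠ 0 → lo * ‖x‖ ^ 2 < inner ℝ (A u x) x) :
    ∃ lo' > lo, ∀ u ∈ K, ∀ x, lo' * ‖x‖ ^ 2 ≤ inner ℝ (A u x) x := by
  have hc : IsCompact (K ×ˢ Metric.sphere (0 : Euc p) 1) := hK.prod (isCompact_sphere 0 1)
  have hcont : ContinuousOn (fun z : Euc p × Euc p => inner ℝ (A z.1 z.2) z.2)
      (K ×ˢ Metric.sphere (0 : Euc p) 1) := by
    refine ContinuousOn.inner ?_ continuousOn_snd
    exact (hA.comp continuousOn_fst fun z hz => hz.1).clm_apply continuousOn_snd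
  have key : ∃ lo' > lo, ∀ z ∈ K ×ˢ Metric.sphere (0 : Euc p) 1,
      lo' ≤ inner ℝ (A z.1 z.2) z.2 := by
    rcases (K ×ˢ Metric.sphere (0 : Euc p) 1).eq_empty_or_nonempty with he | hne
    -- The product is empty also when `p = 0`; any value above `lo` will do.
    · exact ⟨lo + 1, by simp, by simp [he]⟩
    · obtain ⟨z, hz, hmin⟩ := hc.exists_isMinOn hne hcont
      refine ⟨_, ?_, fun y hy => hmin hy⟩
      have h1 : ‖z.2‖ = 1 := by simpa using hz.2
      have := hlo z.1 hz.1 z.2 (by rw [← norm_ne_zero_iff, h1]; norm_num)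
      simpa [h1] using this
  obtain ⟨lo', hlo', h⟩ := key
  refine ⟨lo', hlo', fun u hu x => ?_⟩
  by_cases hx : x = 0
  · simp [hx]
  · have hx' : ‖x‖ ≠ 0 := norm_ne_zero_iff.2 hx
    have := h (u, ‖x‖⁻¹ • x) ⟨hu, by simp [norm_smul, hx']⟩
    simp only [map_smul, inner_smul_left, inner_smul_right] at this
    simp only [conj_trivial] at this
    rw [← mul_assoc, ← mul_inv, ← sq, inv_mul_eq_div, le_div_iff₀ (by positivity)] at this
    exact this

/-- The distribution of `U d` on the event `D = d`, conditionally on `Z = z`. -/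
noncomputable def rankLaw {p : ℕ} {Ω : Type*} [MeasurableSpace Ω] (P : Measure Ω)
    (D Z : Ω → Fin 2) (U : Fin 2 → Ω → Euc p) (d z : Fin 2) : Measure (Euc p) :=
  (P[|Z ⁻¹' {z}].restrict (D ⁻¹' {d})).map (U d)

theorem measurableSet_inter_preimage {E F : Type*} [TopologicalSpace E] [MeasurableSpace E]
    [OpensMeasurableSpace E] [TopologicalSpace F] [MeasurableSpace F] [BorelSpace F] {g : E → F}
    {K : Set E} (hg : ContinuousOn g K) (hK : MeasurableSet K) {C : Set F} (hC : MeasurableSet C) :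
    MeasurableSet (K ∩ g ⁻¹' C) := by
  have h := MeasurableSet.subtype_image hK (hg.domRestrict.measurable hC)
  convert h using 1
  ext x
  simp [and_comm]

/-- Events with the same conditional probability given `m` have the same probability on each
`m`-measurable set. -/
theorem measure_inter_eq_of_condExp_eq {Ω : Type*} {m m₀ : MeasurableSpace Ω} {P : Measure Ω}
    [IsFiniteMeasure P] (hm : m ≤ m₀) {s t S : Set Ω} (hs : MeasurableSet s)
    (ht : MeasurableSet t) (hst : P⟦s | m⟧ =ᵐ[P] P⟦t | m⟧) (hS : MeasurableSet[m] S) :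
    P (s ∩ S) = P (t ∩ S) := by
  have key : ∀ e : Set Ω, MeasurableSet e → P.real (e ∩ S) = ∫ ω in S, (P⟦e | m⟧) ω ∂P := by
    intro e he
    rw [setIntegral_condExp hm ((integrable_const _).indicator he) hS,
      integral_indicator he, Measure.restrict_restrict he]
    simp
  refine (measureReal_eq_measureReal_iff).1 ?_
  rw [key s hs, key t ht]
  exact integral_congr_ae (ae_restrict_of_ae hst)

/-! ### Rank laws of a single model -/

section Model

variable {p : ℕ} {𝒰 : Set (Euc p)} {μ : Measure (Euc p)} {q : Struct p}
  {Ω : Type u} [MeasurableSpace Ω] {P : Measure Ω}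
  {Y : Fin 2 → Ω → Euc p} {D Z : Ω → Fin 2} {U : Fin 2 → Ω → Euc p}

theorem Model.rankLaw_apply (h : Model 𝒰 μ q P Y D Z U) (d z : Fin 2) {B : Set (Euc p)}
    (hB : MeasurableSet B) :
    rankLaw P D Z U d z B = (P (Z ⁻¹' {z}))⁻¹ * P (Z ⁻¹' {z} ∩ (U d ⁻¹' B ∩ D ⁻¹' {d})) := by
  rw [rankLaw, Measure.map_apply (h.measurable_U d) hB,
    Measure.restrict_apply (h.measurable_U d hB),
    cond_apply (h.measurable_Z (measurableSet_singleton z))]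

/-- Rank similarity: on each event `D = d, Z = z` the ranks `U 0` and `U 1` have the same law. -/
theorem Model.measure_rank_eq [IsProbabilityMeasure P] (h : Model 𝒰 μ q P Y D Z U)
    (d d₁ d₂ z : Fin 2) {B : Set (Euc p)} (hB : MeasurableSet B) :
    P (Z ⁻¹' {z} ∩ (U d₁ ⁻¹' B ∩ D ⁻¹' {d})) = P (Z ⁻¹' {z} ∩ (U d₂ ⁻¹' B ∩ D ⁻¹' {d})) := by
  obtain ⟨V, mV, ν, δ, hν, hδ, hD, hrank⟩ := h.assignment
  have hmeas : Measurable (fun ω => (Z ω, ν ω)) := h.measurable_Z.prodMk hν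
  have hle := hmeas.comap_le
  -- Up to a null set this is the event `D = d, Z = z`, written as an event of `(Z, ν)`, where rank
  -- similarity applies.
  set S : Set Ω := (fun ω => (Z ω, ν ω)) ⁻¹' (δ ⁻¹' {d} ∩ Prod.fst ⁻¹' {z}) with hS
  have hSm : MeasurableSet[MeasurableSpace.comap (fun ω => (Z ω, ν ω)) inferInstance] S :=
    ⟨_, (hδ (measurableSet_singleton d)).inter (measurable_fst (measurableSet_singleton z)), rfl⟩
  have hev : ∀ e : Fin 2, P (Z ⁻¹' {z} ∩ (U e ⁻¹' B ∩ D ⁻¹' {d})) = P (U e ⁻¹' B ∩ S) := by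
    intro e
    refine measure_congr ?_
    filter_upwards [hD] with ω hω
    refine propext ?_
    change (Z ω = z ∧ U e ω ∈ B ∧ D ω = d) ↔ (U e ω ∈ B ∧ δ (Z ω, ν ω) = d ∧ Z ω = z)
    rw [hω]
    tauto
  rw [hev, hev]
  exact measure_inter_eq_of_condExp_eq hle (h.measurable_U d₁ hB) (h.measurable_U d₂ hB)
    (hrank d₁ d₂ B hB) hSm

/-- Rank similarity replaces `U 1` by `U 0` on `D = 1`; the two pieces then recombine into the law
of `U 0` given `Z = z`, which is `μ` by independence. -/
theorem Model.rankLaw_add [IsProbabilityMeasure P] (h : Model 𝒰 μ q P Y D Z U) {z : Fin 2}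
    (hz : P (Z ⁻¹' {z}) ≠ 0) :
    rankLaw P D Z U 0 z + rankLaw P D Z U 1 z = μ := by
  ext B hB
  rw [Measure.add_apply, h.rankLaw_apply 0 z hB, h.rankLaw_apply 1 z hB,
    h.measure_rank_eq 1 1 0 z hB, ← mul_add]
  have h1 : P (Z ⁻¹' {z} ∩ (U 0 ⁻¹' B ∩ D ⁻¹' {0})) + P (Z ⁻¹' {z} ∩ (U 0 ⁻¹' B ∩ D ⁻¹' {1}))
      = P (Z ⁻¹' {z} ∩ U 0 ⁻¹' B) := by
    rw [← measure_inter_add_sdiff (Z ⁻¹' {z} ∩ U 0 ⁻¹' B)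
      (h.measurable_D (measurableSet_singleton (0 : Fin 2)))]
    congr 2
    · rw [inter_assoc]
    · ext ω
      simp only [mem_inter_iff, mem_preimage, mem_singleton_iff, Set.mem_sdiff]
      have : D ω = 1 ↔ ¬ D ω = 0 := by omega
      tauto
  have h2 := (h.indep 0).measure_inter_preimage_eq_mul _ _ hB (measurableSet_singleton z)
  rw [h1, inter_comm, h2, mul_comm, mul_assoc, ENNReal.mul_inv_cancel hz (measure_ne_top _ _),
    mul_one, ← h.law_U 0, Measure.map_apply (h.measurable_U 0) hB]

theorem Model.ae_mem (h : Model 𝒰 μ q P Y D Z U) (hμ : μ 𝒰ᶜ = 0) (hU : MeasurableSet 𝒰)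
    (d : Fin 2) : ∀ᵐ ω ∂P, U d ω ∈ 𝒰 := by
  have : P.map (U d) 𝒰ᶜ = 0 := by rw [h.law_U, hμ]
  rwa [Measure.map_apply (h.measurable_U d) hU.compl] at this

/-- The observable probability `ℙ(Y ∈ C, D = d | Z = z)`. -/
noncomputable def obsCond {p : ℕ} (L : Measure (Euc p × Fin 2 × Fin 2)) (d z : Fin 2)
    (C : Set (Euc p)) : ENNReal :=
  (L (univ ×ˢ univ ×ˢ {z}))⁻¹ * L (C ×ˢ {d} ×ˢ {z})

theorem Model.measurable_obsY (h : Model 𝒰 μ q P Y D Z U) : Measurable (obsY Y D) := by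
  have : obsY Y D = fun ω => if D ω = 0 then Y 0 ω else Y 1 ω := by
    ext1 ω
    rw [obsY]
    split_ifs with h0
    · rw [h0]
    · rw [show D ω = 1 by omega]
  rw [this]
  exact Measurable.ite (h.measurable_D (measurableSet_singleton (0 : Fin 2)))
    (h.measurable_Y 0) (h.measurable_Y 1)

theorem Model.obsLaw_prod (h : Model 𝒰 μ q P Y D Z U) {C : Set (Euc p)} (hC : MeasurableSet C)
    (S : Set (Fin 2)) (z : Fin 2) :
    obsLaw P Y D Z (C ×ˢ S ×ˢ {z}) = P (Z ⁻¹' {z} ∩ (obsY Y D ⁻¹' C ∩ D ⁻¹' S)) := by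
  rw [obsLaw, Measure.map_apply (h.measurable_obsY.prodMk (h.measurable_D.prodMk h.measurable_Z))
    (hC.prod ((MeasurableSet.of_discrete).prod (measurableSet_singleton z)))]
  congr 1
  ext ω
  simp only [mem_inter_iff, mem_preimage, mem_singleton_iff, mem_prod]
  tauto

theorem Model.obsLaw_instrument (h : Model 𝒰 μ q P Y D Z U) (z : Fin 2) :
    obsLaw P Y D Z (univ ×ˢ univ ×ˢ {z}) = P (Z ⁻¹' {z}) := by
  simpa using h.obsLaw_prod MeasurableSet.univ univ z

theorem Model.obsCond_obsLaw (h : Model 𝒰 μ q P Y D Z U) {C : Set (Euc p)}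
    (hC : MeasurableSet C) (d z : Fin 2) :
    obsCond (obsLaw P Y D Z) d z C = P[|Z ⁻¹' {z}] (obsY Y D ⁻¹' C ∩ D ⁻¹' {d}) := by
  rw [obsCond, h.obsLaw_instrument, h.obsLaw_prod hC,
    cond_apply (h.measurable_Z (measurableSet_singleton z))]

theorem Model.obsCond_eq_rankLaw (h : Model 𝒰 μ q P Y D Z U) (hμ : μ 𝒰ᶜ = 0)
    (hU : MeasurableSet 𝒰) (d z : Fin 2) (hcont : ContinuousOn (q d) 𝒰)
    {C : Set (Euc p)} (hC : MeasurableSet C) :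
    obsCond (obsLaw P Y D Z) d z C = rankLaw P D Z U d z (𝒰 ∩ q d ⁻¹' C) := by
  rw [obsCond, h.obsLaw_instrument, h.obsLaw_prod hC,
    h.rankLaw_apply d z (measurableSet_inter_preimage hcont hU hC)]
  congr 1
  refine measure_congr ?_
  filter_upwards [h.ae_mem hμ hU d, h.outcome d] with ω h1 h2
  refine propext ?_
  change (Z ω = z ∧ Y (D ω) ω ∈ C ∧ D ω = d) ↔
    (Z ω = z ∧ (U d ω ∈ 𝒰 ∧ q d (U d ω) ∈ C) ∧ D ω = d)
  refine and_congr_right fun _ => and_congr_left fun hd => ?_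
  rw [hd, h2]
  tauto

theorem Model.rankLaw_eq_obsCond_image (h : Model 𝒰 μ q P Y D Z U) (hμ : μ 𝒰ᶜ = 0)
    (hU : MeasurableSet 𝒰) (d z : Fin 2) (hcont : ContinuousOn (q d) 𝒰) (hinj : InjOn (q d) 𝒰)
    {B : Set (Euc p)} (hB : MeasurableSet B) (hBU : B ⊆ 𝒰) :
    rankLaw P D Z U d z B = obsCond (obsLaw P Y D Z) d z (q d '' B) := by
  rw [h.obsCond_eq_rankLaw hμ hU d z hcont
    (hB.image_of_continuousOn_injOn (hcont.mono hBU) (hinj.mono hBU)), inter_comm,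
    hinj.preimage_image_inter hBU]

/-- Every neighbourhood of a point of `𝒰` is charged by `μ`. The inclusion allows the densities,
which are given on the support of `Y_d` only, to be used on the whole image of `𝒰`. -/
theorem Model.image_subset_suppY (h : Model 𝒰 μ q P Y D Z U) (hμ : μ 𝒰ᶜ = 0)
    (hU : MeasurableSet 𝒰) (hsupp : μ.support = 𝒰) (d : Fin 2) (hcont : ContinuousOn (q d) 𝒰) :
    q d '' 𝒰 ⊆ suppY P Y d := by
  rintro _ ⟨u, hu, rfl⟩
  rw [suppY, Measure.mem_support_iff_forall]
  intro N hN
  obtain ⟨V, hVN, hV, huV⟩ := mem_nhds_iff.1 hN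
  obtain ⟨O, hO, hOV⟩ := continuousOn_iff'.1 hcont V hV
  have huO : u ∈ O := (hOV.subset ⟨huV, hu⟩).1
  rw [← hsupp, Measure.mem_support_iff_forall] at hu
  refine lt_of_lt_of_le ?_ (measure_mono hVN)
  rw [Measure.map_apply (h.measurable_Y d) hV.measurableSet]
  refine (hu O (hO.mem_nhds huO)).trans_le ?_
  rw [← h.law_U d, Measure.map_apply (h.measurable_U d) hO.measurableSet]
  refine measure_mono_ae ?_
  filter_upwards [h.ae_mem hμ hU d, h.outcome d] with ω h1 h2 h3
  change Y d ω ∈ V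
  rw [h2]
  exact (hOV.superset ⟨h3, h1⟩).1

/-- Change of variables: the density of the rank law. -/
theorem Model.rankLaw_eq_setLIntegral (h : Model 𝒰 μ q P Y D Z U) (hμ : μ 𝒰ᶜ = 0)
    (hU : MeasurableSet 𝒰) (hsupp : μ.support = 𝒰) (d z : Fin 2) (hinj : InjOn (q d) 𝒰)
    {A : Euc p → Euc p →L[ℝ] Euc p} (hA : ∀ u ∈ 𝒰, HasFDerivWithinAt (q d) (A u) 𝒰 u)
    {f : Euc p → ℝ} (hf : IsDensity P Y D Z d z f) {B : Set (Euc p)} (hB : MeasurableSet B)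
    (hBU : B ⊆ 𝒰) :
    rankLaw P D Z U d z B = ∫⁻ u in B, ENNReal.ofReal (f (q d u) * |(A u).det|) := by
  have hcont : ContinuousOn (q d) 𝒰 := fun u hu => (hA u hu).continuousWithinAt
  have himg : MeasurableSet (q d '' B) :=
    hB.image_of_continuousOn_injOn (hcont.mono hBU) (hinj.mono hBU)
  rw [h.rankLaw_eq_obsCond_image hμ hU d z hcont hinj hB hBU, h.obsCond_obsLaw himg, hf.2 _ himg,
    inter_eq_left.2 ((image_mono hBU).trans (h.image_subset_suppY hμ hU hsupp d hcont)),
    lintegral_image_eq_lintegral_abs_det_fderiv_mul volume hB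
      (fun u hu => (hA u (hBU hu)).mono hBU) (hinj.mono hBU)]
  refine lintegral_congr fun u => ?_
  rw [mul_comm, ENNReal.ofReal_mul' (abs_nonneg _)]

theorem Model.rankLaw_le [IsProbabilityMeasure P] (h : Model 𝒰 μ q P Y D Z U) (d : Fin 2)
    {z : Fin 2} (hz : P (Z ⁻¹' {z}) ≠ 0) : rankLaw P D Z U d z ≤ μ := by
  rw [← h.rankLaw_add hz]
  fin_cases d
  · exact Measure.le_add_right le_rfl
  · exact Measure.le_add_left le_rfl

theorem Model.rankLaw_eq_withDensity [IsProbabilityMeasure P] (h : Model 𝒰 μ q P Y D Z U)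
    (hμ : μ 𝒰ᶜ = 0) (hU : MeasurableSet 𝒰) (hsupp : μ.support = 𝒰) (d : Fin 2) {z : Fin 2}
    (hz : P (Z ⁻¹' {z}) ≠ 0) (hinj : InjOn (q d) 𝒰)
    {A : Euc p → Euc p →L[ℝ] Euc p} (hA : ∀ u ∈ 𝒰, HasFDerivWithinAt (q d) (A u) 𝒰 u)
    {f : Euc p → ℝ} (hf : IsDensity P Y D Z d z f) :
    rankLaw P D Z U d z = (volume.restrict 𝒰).withDensity
      fun u => ENNReal.ofReal (f (q d u) * |(A u).det|) := by
  have h0 : rankLaw P D Z U d z 𝒰ᶜ = 0 := le_antisymm ((h.rankLaw_le d hz 𝒰ᶜ).trans hμ.le) zero_le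
  ext B hB
  rw [← measure_inter_conull h0, h.rankLaw_eq_setLIntegral hμ hU hsupp d z hinj hA hf
    (hB.inter hU) inter_subset_right, withDensity_apply _ hB, Measure.restrict_restrict hB]

end Model

/-! ### Coercivity of the quadratic form -/

/-- The square of the left side is at most `r (s + t)² x y ≤ 4 κ² (a x) (b y)`, and the
arithmetic-geometric mean inequality finishes. -/
theorem abs_cross_le {x y c₁ c₂ r κ a b s t : ℝ} (hx : 0 ≤ x) (hy : 0 ≤ y) (ha : 0 ≤ a)
    (hb : 0 ≤ b) (hs : 0 ≤ s) (ht : 0 ≤ t) (hκ : 0 ≤ κ)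
    (hc₁ : c₁ ^ 2 ≤ r * (x * y)) (hc₂ : c₂ ^ 2 ≤ r * (x * y))
    (h : r * (s + t) ^ 2 ≤ 4 * κ ^ 2 * (a * b)) :
    |s * c₁ + t * c₂| ≤ κ * (a * x + b * y) := by
  refine abs_le_of_sq_le_sq ?_ (by positivity)
  have hxy : 0 ≤ x * y := mul_nonneg hx hy
  have h12 : c₁ * c₂ ≤ r * (x * y) := by nlinarith [sq_nonneg (c₁ - c₂)]
  calc (s * c₁ + t * c₂) ^ 2 = s ^ 2 * c₁ ^ 2 + t ^ 2 * c₂ ^ 2 + 2 * (s * t) * (c₁ * c₂) := by ring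
    _ ≤ s ^ 2 * (r * (x * y)) + t ^ 2 * (r * (x * y)) + 2 * (s * t) * (r * (x * y)) := by gcongr
    _ = (r * (s + t) ^ 2) * (x * y) := by ring
    _ ≤ (4 * κ ^ 2 * (a * b)) * (x * y) := by gcongr
    _ = κ ^ 2 * (4 * (a * x) * (b * y)) := by ring
    _ ≤ κ ^ 2 * (a * x + b * y) ^ 2 := by
        gcongr
        nlinarith [sq_nonneg (a * x - b * y)]
    _ = _ := by ring

/-- Cauchy-Schwarz in the form `A`, then `⟨A y, y⟩` is exchanged for `⟨B y, y⟩` at the price `hi /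
lo`. This accounts for the `+ 1` in the exponent `p + 1`. -/
theorem inner_sq_le_of_bounds {p : ℕ} {A B : Euc p →L[ℝ] Euc p} {lo hi : ℝ} (hlo : 0 < lo)
    (hs : ∀ x y, inner ℝ (A x) y = inner ℝ x (A y))
    (hA : ∀ x, lo * ‖x‖ ^ 2 ≤ inner ℝ (A x) x) (hA' : ∀ x, inner ℝ (A x) x ≤ hi * ‖x‖ ^ 2)
    (hB : ∀ x, lo * ‖x‖ ^ 2 ≤ inner ℝ (B x) x) (hhi : 0 ≤ hi) (x y : Euc p) :
    (inner ℝ (A x) y) ^ 2 ≤ hi / lo * (inner ℝ (A x) x * inner ℝ (B y) y) := by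
  have hpos : ∀ x, 0 ≤ inner ℝ (A x) x := fun x => le_trans (by positivity) (hA x)
  calc (inner ℝ (A x) y) ^ 2 ≤ inner ℝ (A x) x * inner ℝ (A y) y := inner_sq_le_mul hs hpos x y
    _ ≤ inner ℝ (A x) x * (hi * ‖y‖ ^ 2) := mul_le_mul_of_nonneg_left (hA' y) (hpos x)
    _ ≤ inner ℝ (A x) x * (hi * (inner ℝ (B y) y / lo)) := by
        refine mul_le_mul_of_nonneg_left (mul_le_mul_of_nonneg_left ?_ hhi) (hpos x)
        rw [le_div_iff₀ hlo, mul_comm]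
        exact hB y
    _ = _ := by ring

/-- Positive definiteness of the quadratic form attached to the linearized restrictions. -/
theorem quadratic_lower_bound {p : ℕ} {A : Fin 2 → Euc p →L[ℝ] Euc p} {lo hi : ℝ} (hlo : 0 < lo)
    (hhi : 0 ≤ hi)
    (hs : ∀ d x y, inner ℝ (A d x) y = inner ℝ x (A d y))
    (hA : ∀ d x, lo * ‖x‖ ^ 2 ≤ inner ℝ (A d x) x)
    (hA' : ∀ d x, inner ℝ (A d x) x ≤ hi * ‖x‖ ^ 2)
    {a : Fin 2 → Fin 2 → ℝ} (ha : ∀ d z, 0 ≤ a d z) {κ : ℝ} (hκ : 0 ≤ κ) (hκ1 : κ ≤ 1)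
    (h : hi / lo * (a 1 0 + a 0 1) ^ 2 ≤ 4 * κ ^ 2 * (a 0 0 * a 1 1)) (w : Fin 2 → Euc p) :
    (1 - κ) * lo * (min (a 0 0) (a 1 1) * (‖w 0‖ ^ 2 + ‖w 1‖ ^ 2)) ≤
      ∑ z, ∑ d, a d z * inner ℝ (A z (w z)) (w d) := by
  have hpos : ∀ d x, 0 ≤ inner ℝ (A d x) x := fun d x => le_trans (by positivity) (hA d x)
  have hc := abs_cross_le (hpos 0 (w 0)) (hpos 1 (w 1)) (ha 0 0) (ha 1 1) (ha 1 0) (ha 0 1) hκ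
    (inner_sq_le_of_bounds hlo (hs 0) (hA 0) (hA' 0) (hA 1) hhi (w 0) (w 1))
    (c₂ := inner ℝ (A 1 (w 1)) (w 0))
    (by
      rw [mul_comm (inner ℝ (A 0 (w 0)) (w 0))]
      exact inner_sq_le_of_bounds hlo (hs 1) (hA 1) (hA' 1) (hA 0) hhi (w 1) (w 0)) h
  have hc' := (abs_le.1 hc).1
  simp only [Fin.sum_univ_two]
  have h0 : min (a 0 0) (a 1 1) * (lo * ‖w 0‖ ^ 2) ≤ a 0 0 * inner ℝ (A 0 (w 0)) (w 0) :=
    mul_le_mul (min_le_left _ _) (hA 0 _) (by positivity) (ha 0 0)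
  have h1 : min (a 0 0) (a 1 1) * (lo * ‖w 1‖ ^ 2) ≤ a 1 1 * inner ℝ (A 1 (w 1)) (w 1) :=
    mul_le_mul (min_le_right _ _) (hA 1 _) (by positivity) (ha 1 1)
  have h2 := mul_le_mul_of_nonneg_left (add_le_add h0 h1) (sub_nonneg.2 hκ1)
  linarith

/-- The Jacobians `J₀`, `J₁` differ by at most the factor `(hi / lo') ^ p`, so they can be pulled
out of the square as `J₀ J₁`. Since `lo'` replaces `lo` in the constants, a factor `(lo / lo') ^ (p
+ 1)` is gained; it becomes `κ²`. -/
theorem weighted_sum_bound {p : ℕ} {lo' lo hi J₀ J₁ f₀₀ f₀₁ f₁₀ f₁₁ : ℝ} (hlo : 0 < lo)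
    (hlo' : lo < lo') (hhi : lo' ≤ hi) (hJ₀ : lo' ^ p ≤ J₀) (hJ₀' : J₀ ≤ hi ^ p)
    (hJ₁ : lo' ^ p ≤ J₁) (hJ₁' : J₁ ≤ hi ^ p) (h₀₁ : 0 ≤ f₀₁) (h₁₀ : 0 ≤ f₁₀)
    (h : (hi / lo) ^ (p + 1) * (f₀₁ + f₁₀) ^ 2 ≤ 4 * f₀₀ * f₁₁) :
    hi / lo' * (f₁₀ * J₁ + f₀₁ * J₀) ^ 2 ≤
      4 * Real.sqrt ((lo / lo') ^ (p + 1)) ^ 2 * (f₀₀ * J₀ * (f₁₁ * J₁)) := by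
  have hl : 0 < lo' := hlo.trans hlo'
  have hh : 0 < hi := hl.trans_le hhi
  have hJ₀p : 0 < J₀ := (pow_pos hl p).trans_le hJ₀
  have hJ₁p : 0 < J₁ := (pow_pos hl p).trans_le hJ₁
  have hρ : 1 ≤ (hi / lo') ^ p := one_le_pow₀ ((one_le_div hl).2 hhi)
  have hmul : (hi / lo') ^ p * lo' ^ p = hi ^ p := by
    rw [← mul_pow, div_mul_cancel₀ _ hl.ne']
  have h10 : J₁ ≤ (hi / lo') ^ p * J₀ := by
    calc J₁ ≤ (hi / lo') ^ p * lo' ^ p := hmul ▸ hJ₁'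
      _ ≤ _ := by gcongr
  have h01 : J₀ ≤ (hi / lo') ^ p * J₁ := by
    calc J₀ ≤ (hi / lo') ^ p * lo' ^ p := hmul ▸ hJ₀'
      _ ≤ _ := by gcongr
  rw [Real.sq_sqrt (by positivity)]
  have hmain : (f₁₀ * J₁ + f₀₁ * J₀) ^ 2 ≤ (hi / lo') ^ p * (J₀ * J₁) * (f₀₁ + f₁₀) ^ 2 := by
    have e1 : f₁₀ ^ 2 * J₁ * J₁ ≤ f₁₀ ^ 2 * J₁ * ((hi / lo') ^ p * J₀) := by gcongr
    have e2 : f₀₁ ^ 2 * J₀ * J₀ ≤ f₀₁ ^ 2 * J₀ * ((hi / lo') ^ p * J₁) := by gcongr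
    have e3 : 2 * f₀₁ * f₁₀ * J₀ * J₁ * 1 ≤ 2 * f₀₁ * f₁₀ * J₀ * J₁ * (hi / lo') ^ p := by gcongr
    linarith
  have hconst : (hi / lo') ^ (p + 1) = (lo / lo') ^ (p + 1) * (hi / lo) ^ (p + 1) := by
    rw [← mul_pow]
    congr 1
    field_simp
  calc hi / lo' * (f₁₀ * J₁ + f₀₁ * J₀) ^ 2
      ≤ hi / lo' * ((hi / lo') ^ p * (J₀ * J₁) * (f₀₁ + f₁₀) ^ 2) := by gcongr
    _ = (hi / lo') ^ (p + 1) * (J₀ * J₁) * (f₀₁ + f₁₀) ^ 2 := by ring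
    _ = (lo / lo') ^ (p + 1) * (J₀ * J₁) * ((hi / lo) ^ (p + 1) * (f₀₁ + f₁₀) ^ 2) := by
        rw [hconst]; ring
    _ ≤ (lo / lo') ^ (p + 1) * (J₀ * J₁) * (4 * f₀₀ * f₁₁) := by gcongr
    _ = _ := by ring

/-! ### From almost everywhere positivity to uniform bounds -/

theorem setIntegral_pos_of_ae_pos {α : Type*} [MeasurableSpace α] {m : Measure α} {s : Set α}
    (hs : MeasurableSet s) (hms : m s ≠ 0) {g : α → ℝ} (hInt : IntegrableOn g s m)
    (hg : ∀ᵐ x ∂m.restrict s, 0 < g x) : 0 < ∫ x in s, g x ∂m := by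
  rw [setIntegral_pos_iff_support_of_nonneg_ae (hg.mono fun _ h => h.le) hInt]
  refine (pos_iff_ne_zero.2 hms).trans_le (measure_mono_ae ?_)
  rw [ae_restrict_iff' hs] at hg
  filter_upwards [hg] with x hx hxs
  exact ⟨(hx hxs).ne', hxs⟩

/-- A continuous weight that is a.e. positive on a compact convex body has mass bounded below
on balls of a fixed radius. -/
theorem exists_lower_bound_ball {p : ℕ} {K : Set (Euc p)} (hK : IsCompact K)
    (hconv : Convex ℝ K) (hInt : (interior K).Nonempty) {g : Euc p → ℝ} (hg : ContinuousOn g K)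
    (hg0 : ∀ x ∈ K, 0 ≤ g x) (hpos : ∀ᵐ x ∂volume.restrict K, 0 < g x) {δ : ℝ} (hδ : 0 < δ) :
    ∃ c > 0, ∀ u ∈ K, c ≤ ∫ x in Metric.ball u δ ∩ K, g x := by
  have hgi : IntegrableOn g K := hg.integrableOn_compact hK
  refine hK.induction_on (p := fun s => ∃ c > 0, ∀ u ∈ s, c ≤ ∫ x in Metric.ball u δ ∩ K, g x)
    ⟨1, one_pos, by simp⟩ (fun s t hst ⟨c, hc, h⟩ => ⟨c, hc, fun u hu => h u (hst hu)⟩)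
    (fun s t ⟨c, hc, h⟩ ⟨c', hc', h'⟩ => ⟨min c c', lt_min hc hc', fun u hu => ?_⟩)
    (fun x hx => ?_)
  · rcases hu with hu | hu
    · exact (min_le_left _ _).trans (h u hu)
    · exact (min_le_right _ _).trans (h' u hu)
  -- For `u` within `δ / 2` of `x`, the ball of radius `δ` at `u` contains the fixed ball of radius
  -- `δ / 2` at `x`; compactness then needs finitely many centres.
  · refine ⟨Metric.ball x (δ / 2), mem_nhdsWithin_of_mem_nhds (Metric.ball_mem_nhds x (by positivity)),
      ∫ y in Metric.ball x (δ / 2) ∩ K, g y, ?_, fun u hu => ?_⟩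
    · refine setIntegral_pos_of_ae_pos (Metric.isOpen_ball.measurableSet.inter hK.measurableSet)
        (measure_inter_pos volume hconv hInt Metric.isOpen_ball
          ⟨x, Metric.mem_ball_self (by positivity), hx⟩).ne'
        (hgi.mono_set inter_subset_right)
        (ae_restrict_of_ae_restrict_of_subset inter_subset_right hpos)
    · refine setIntegral_mono_set (hgi.mono_set inter_subset_right) ?_ ?_
      · filter_upwards [ae_restrict_mem (Metric.isOpen_ball.measurableSet.inter hK.measurableSet)]
          with y hy using hg0 y hy.2
      · refine (inter_subset_inter_left K fun y hy => ?_).eventuallyLE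
        rw [Metric.mem_ball] at hu hy ⊢
        have := dist_triangle y x u
        rw [dist_comm x u] at this
        linarith

/-- A non-strict inequality between continuous functions that holds a.e. on a product of convex
bodies holds everywhere. -/
theorem forall_le_of_ae_prod {p : ℕ} {S T : Set (Euc p)} (hS : Convex ℝ S) (hT : Convex ℝ T)
    (hSi : (interior S).Nonempty) (hTi : (interior T).Nonempty) {g : Euc p × Euc p → ℝ}
    (hg : ContinuousOn g (S ×ˢ T))
    (h : ∀ᵐ y : Euc p × Euc p ∂(volume.restrict (S ×ˢ T)), 0 ≤ g y) :
    ∀ y ∈ S ×ˢ T, 0 ≤ g y := by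
  intro y hy
  by_contra hneg
  obtain ⟨O, hO, hOg⟩ := continuousOn_iff'.1 hg (Iio 0) isOpen_Iio
  have hyO : y ∈ O ∩ S ×ˢ T := hOg ▸ ⟨not_le.1 hneg, hy⟩
  have hpos := measure_inter_pos volume (hS.prod hT)
    (by rw [interior_prod_eq]; exact hSi.prod hTi) hO ⟨y, hyO⟩
  rw [ae_iff] at h
  refine hpos.ne' (measure_mono_null (fun x hx => ?_)
    (nonpos_iff_eq_zero.1 ((Measure.le_restrict_apply _ _).trans h.le)))
  have hx' := hOg.superset hx
  exact ⟨not_le.2 hx'.1, hx'.2⟩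

/-! ### First-order expansions and the perturbation argument -/

/-- First-order expansion of `h u` along the displacement `T u - u` that is caused by perturbing
`Q` to `Q + α h`. -/
theorem displacement_bounds {p : ℕ} {𝒰 : Set (Euc p)} (hconv : Convex ℝ 𝒰) {Q h : Euc p → Euc p}
    {A : Euc p → Euc p →L[ℝ] Euc p} (hQ : ∀ u ∈ 𝒰, HasFDerivWithinAt Q (A u) 𝒰 u)
    {lo η r α K M : ℝ} (hlo : 0 < lo) (hα : 0 < α) (hη : 0 ≤ η) (hK : 0 ≤ K)
    (hA : ∀ u ∈ 𝒰, ∀ x, lo * ‖x‖ ^ 2 ≤ inner ℝ (A u x) x)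
    (hmod : ∀ x ∈ 𝒰, ∀ y ∈ 𝒰, ‖x - y‖ ≤ r → ‖A x - A y‖ ≤ η) (hr : α * (M / lo) ≤ r)
    (hLip : ∀ x ∈ 𝒰, ∀ y ∈ 𝒰, ‖h x - h y‖ ≤ K * ‖x - y‖) (hM : ∀ x ∈ 𝒰, ‖h x‖ ≤ M)
    {u v : Euc p} (hu : u ∈ 𝒰) (hv : v ∈ 𝒰) (huv : Q v + α • h v = Q u) :
    ‖α⁻¹ • (u - v)‖ ≤ M / lo ∧ ‖h u - A u (α⁻¹ • (u - v))‖ ≤ (η + K * α) * (M / lo) := by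
  have hQuv : Q u - Q v = α • h v := by rw [← huv]; abel
  -- Strong monotonicity of `Q` makes the displacement of order `α`.
  have h1 : ‖u - v‖ ≤ α * (M / lo) := by
    have := strong_monotone hconv hQ hA hu hv
    rw [hQuv, norm_smul, Real.norm_of_nonneg hα.le] at this
    have h2 := mul_le_mul_of_nonneg_left (hM v hv) hα.le
    rw [← mul_div_assoc, le_div_iff₀ hlo]
    linarith
  have hw : ‖α⁻¹ • (u - v)‖ ≤ M / lo := by
    rw [norm_smul, norm_inv, Real.norm_of_nonneg hα.le, inv_mul_le_iff₀ hα]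
    exact h1
  refine ⟨hw, ?_⟩
  have h3 := norm_sub_sub_le_of_near hconv hQ hmod hu hv (h1.trans hr)
  have h4 : ‖h v - A u (α⁻¹ • (u - v))‖ ≤ η * (M / lo) := by
    have : h v - A u (α⁻¹ • (u - v)) = α⁻¹ • (Q u - Q v - A u (u - v)) := by
      rw [hQuv, smul_sub α⁻¹ (α • h v), smul_smul, inv_mul_cancel₀ hα.ne', one_smul, map_smul]
    rw [this, norm_smul, norm_inv, Real.norm_of_nonneg hα.le, inv_mul_le_iff₀ hα]
    calc _ ≤ η * ‖u - v‖ := h3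
      _ ≤ η * (α * (M / lo)) := by gcongr
      _ = _ := by ring
  have h5 : ‖h u - h v‖ ≤ K * α * (M / lo) := by
    calc _ ≤ K * ‖u - v‖ := hLip u hu v hv
      _ ≤ K * (α * (M / lo)) := by gcongr
      _ = _ := by ring
  calc _ = ‖(h u - h v) + (h v - A u (α⁻¹ • (u - v)))‖ := by congr 1; abel
    _ ≤ _ := norm_add_le _ _
    _ ≤ K * α * (M / lo) + η * (M / lo) := add_le_add h5 h4
    _ = _ := by ring

/-- Taylor expansion of `ψ` at `u`, with gradient `h u` replaced by an approximation `b`. It is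
applied with `b = A w`, the value that enters the quadratic form. -/
theorem potential_increment_lower_bound {p : ℕ} {𝒰 : Set (Euc p)} (hconv : Convex ℝ 𝒰)
    {h : Euc p → Euc p} {ψ : Euc p → ℝ}
    (hψ : ∀ x ∈ 𝒰, HasFDerivWithinAt ψ (innerSL ℝ (h x)) 𝒰 x) {α K W e : ℝ} (hα : 0 < α)
    (hK : 0 ≤ K) (he : 0 ≤ e)
    (hLip : ∀ x ∈ 𝒰, ∀ y ∈ 𝒰, ‖h x - h y‖ ≤ K * ‖x - y‖) {u v b : Euc p} (hu : u ∈ 𝒰)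
    (hv : v ∈ 𝒰) (hw : ‖α⁻¹ • (u - v)‖ ≤ W) (hb : ‖h u - b‖ ≤ e) :
    inner ℝ b (α⁻¹ • (u - v)) ≤ α⁻¹ * (ψ u - ψ v) + (K * α * W ^ 2 + e * W) := by
  have h1 := (abs_le.1 (abs_potential_sub_le hconv hψ hK hLip hu hv)).1
  have h2 : -(inner ℝ (h u - b) (α⁻¹ • (u - v))) ≤ e * W := by
    refine (neg_le_abs _).trans ((abs_real_inner_le_norm _ _).trans ?_)
    gcongr
  have h3 : u - v = α • (α⁻¹ • (u - v)) := by rw [smul_smul, mul_inv_cancel₀ hα.ne', one_smul]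
  set w := α⁻¹ • (u - v)
  rw [h3, inner_smul_right, norm_smul, Real.norm_of_nonneg hα.le] at h1
  rw [inner_sub_left] at h2
  have h4 : inner ℝ (h u) w ≤ α⁻¹ * (ψ u - ψ v) + K * α * ‖w‖ ^ 2 := by
    have : inner ℝ (h u) w = α⁻¹ * (α * inner ℝ (h u) w) := by field_simp
    rw [this]
    have h5 : K * α * ‖w‖ ^ 2 = α⁻¹ * (K * (α * ‖w‖) ^ 2) := by field_simp
    rw [h5, ← mul_add]
    gcongr
    linarith
  have h6 : K * α * ‖w‖ ^ 2 ≤ K * α * W ^ 2 := by gcongr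
  linarith

theorem norm_sq_le_of_near {p : ℕ} {A : Euc p →L[ℝ] Euc p} {hi e : ℝ} (hA : ∀ x, ‖A x‖ ≤ hi * ‖x‖)
    {b w : Euc p} (hb : ‖b - A w‖ ≤ e) : ‖b‖ ^ 2 ≤ 2 * hi ^ 2 * ‖w‖ ^ 2 + 2 * e ^ 2 := by
  have h1 : ‖b‖ ≤ hi * ‖w‖ + e := by
    calc ‖b‖ = ‖A w + (b - A w)‖ := by congr 1; abel
      _ ≤ _ := (norm_add_le _ _).trans (add_le_add (hA w) hb)
  have := pow_le_pow_left₀ (norm_nonneg b) h1 2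
  nlinarith [sq_nonneg (hi * ‖w‖ - e)]

/-- Pointwise lower bound for the sum of the increments of the potentials. -/
theorem increment_lower_bound {p : ℕ} {𝒰 : Set (Euc p)} (hconv : Convex ℝ 𝒰)
    {Q : Struct p} {A : Fin 2 → Euc p → Euc p →L[ℝ] Euc p}
    (hQ : ∀ d, ∀ u ∈ 𝒰, HasFDerivWithinAt (Q d) (A d u) 𝒰 u)
    (hs : ∀ d, ∀ u ∈ 𝒰, ∀ x y, inner ℝ (A d u x) y = inner ℝ x (A d u y))
    {lo hi : ℝ} (hlo : 0 < lo) (hhi : 0 < hi)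
    (hA : ∀ d, ∀ u ∈ 𝒰, ∀ x, lo * ‖x‖ ^ 2 ≤ inner ℝ (A d u x) x)
    (hA' : ∀ d, ∀ u ∈ 𝒰, ∀ x, inner ℝ (A d u x) x ≤ hi * ‖x‖ ^ 2)
    {a : Fin 2 → Fin 2 → ℝ} (ha : ∀ d z, 0 ≤ a d z) {κ : ℝ} (hκ : 0 ≤ κ) (hκ1 : κ ≤ 1)
    (hweight : hi / lo * (a 1 0 + a 0 1) ^ 2 ≤ 4 * κ ^ 2 * (a 0 0 * a 1 1))
    {η r α K M : ℝ} (hα : 0 < α) (hη : 0 ≤ η) (hK : 0 ≤ K)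
    (hmod : ∀ d, ∀ x ∈ 𝒰, ∀ y ∈ 𝒰, ‖x - y‖ ≤ r → ‖A d x - A d y‖ ≤ η) (hr : α * (M / lo) ≤ r)
    {h : Struct p} {ψ : Fin 2 → Euc p → ℝ}
    (hψ : ∀ z, ∀ x ∈ 𝒰, HasFDerivWithinAt (ψ z) (innerSL ℝ (h z x)) 𝒰 x)
    (hLip : ∀ d, ∀ x ∈ 𝒰, ∀ y ∈ 𝒰, ‖h d x - h d y‖ ≤ K * ‖x - y‖)
    (hM : ∀ d, ∀ x ∈ 𝒰, ‖h d x‖ ≤ M) {u : Euc p} (hu : u ∈ 𝒰) {v : Fin 2 → Euc p}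
    (hv : ∀ d, v d ∈ 𝒰) (huv : ∀ d, Q d (v d) + α • h d (v d) = Q d u) :
    (1 - κ) * lo / (2 * hi ^ 2) * (min (a 0 0) (a 1 1) * (‖h 0 u‖ ^ 2 + ‖h 1 u‖ ^ 2)) ≤
      (1 - κ) * lo / (2 * hi ^ 2) * (4 * ((η + K * α) * (M / lo)) ^ 2 * a 0 0) +
      ∑ z, ∑ d, (α⁻¹ * ((ψ z u - ψ z (v d)) * a d z) +
        (K * α * (M / lo) ^ 2 + (η + K * α) * (M / lo) * (M / lo)) * a d z) := by
  set e := (η + K * α) * (M / lo) with he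
  set w : Fin 2 → Euc p := fun d => α⁻¹ • (u - v d) with hw
  have hb : ∀ d, ‖w d‖ ≤ M / lo ∧ ‖h d u - A d u (w d)‖ ≤ e := fun d =>
    displacement_bounds hconv (hQ d) hlo hα hη hK (hA d) (hmod d) hr (hLip d) (hM d) hu (hv d)
      (huv d)
  have he0 : 0 ≤ e := (norm_nonneg _).trans (hb 0).2
  have hquad := quadratic_lower_bound hlo hhi.le (fun d => hs d u hu) (fun d => hA d u hu)
    (fun d => hA' d u hu) ha hκ hκ1 hweight w
  have hnorm : ∀ d, ‖h d u‖ ^ 2 ≤ 2 * hi ^ 2 * ‖w d‖ ^ 2 + 2 * e ^ 2 := fun d =>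
    norm_sq_le_of_near (norm_apply_le (hs d u hu)
      (fun x => le_trans (by positivity) (hA d u hu x)) (hA' d u hu) hhi.le) (hb d).2
  have hm0 : 0 ≤ min (a 0 0) (a 1 1) := le_min (ha 0 0) (ha 1 1)
  have hθ : 0 ≤ (1 - κ) * lo / (2 * hi ^ 2) :=
    div_nonneg (mul_nonneg (sub_nonneg.2 hκ1) hlo.le) (by positivity)
  have hinc : ∑ z, ∑ d, a d z * inner ℝ (A z u (w z)) (w d) ≤
      ∑ z, ∑ d, (α⁻¹ * ((ψ z u - ψ z (v d)) * a d z) +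
        (K * α * (M / lo) ^ 2 + e * (M / lo)) * a d z) := by
    refine Finset.sum_le_sum fun z _ => Finset.sum_le_sum fun d _ => ?_
    have := mul_le_mul_of_nonneg_left (potential_increment_lower_bound hconv (hψ z) hα hK he0
      (hLip z) hu (hv d) (hb d).1 (hb z).2) (ha d z)
    linarith
  refine le_trans ?_ (add_le_add_right (hquad.trans hinc) _)
  -- Coercivity in `w` becomes coercivity in `h`, because `h d u` is within `e` of `A d u (w d)`;
  -- each of the two indices contributes an error `2 e²`.
  have h1 : min (a 0 0) (a 1 1) * (‖h 0 u‖ ^ 2 + ‖h 1 u‖ ^ 2) ≤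
      2 * hi ^ 2 * (min (a 0 0) (a 1 1) * (‖w 0‖ ^ 2 + ‖w 1‖ ^ 2)) + 4 * e ^ 2 * a 0 0 := by
    have h2 := mul_le_mul_of_nonneg_left (add_le_add (hnorm 0) (hnorm 1)) hm0
    have h3 : 4 * e ^ 2 * min (a 0 0) (a 1 1) ≤ 4 * e ^ 2 * a 0 0 := by
      gcongr
      exact min_le_left _ _
    linarith
  have h4 := mul_le_mul_of_nonneg_left h1 hθ
  have h5 : (1 - κ) * lo / (2 * hi ^ 2) *
      (2 * hi ^ 2 * (min (a 0 0) (a 1 1) * (‖w 0‖ ^ 2 + ‖w 1‖ ^ 2))) =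
      (1 - κ) * lo * (min (a 0 0) (a 1 1) * (‖w 0‖ ^ 2 + ‖w 1‖ ^ 2)) := by
    field_simp
  rw [mul_add ((1 - κ) * lo / (2 * hi ^ 2)) (2 * hi ^ 2 * _), h5] at h4
  linarith

/-- Small perturbations `Q + α h` of `Q` that satisfy the moment restrictions for the potentials
of `h` are trivial: `h` cannot be of size `1 / 2` anywhere. -/
theorem exists_perturbation_radius {p : ℕ} {𝒰 : Set (Euc p)} (hcomp : IsCompact 𝒰)
    (hconv : Convex ℝ 𝒰) (hInt : (interior 𝒰).Nonempty)
    {Q : Struct p} {A : Fin 2 → Euc p → Euc p →L[ℝ] Euc p}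
    (hQ : ∀ d, ∀ u ∈ 𝒰, HasFDerivWithinAt (Q d) (A d u) 𝒰 u)
    (hAc : ∀ d, ContinuousOn (A d) 𝒰)
    (hs : ∀ d, ∀ u ∈ 𝒰, ∀ x y, inner ℝ (A d u x) y = inner ℝ x (A d u y))
    {lo hi : ℝ} (hlo : 0 < lo) (hhi : 0 < hi)
    (hA : ∀ d, ∀ u ∈ 𝒰, ∀ x, lo * ‖x‖ ^ 2 ≤ inner ℝ (A d u x) x)
    (hA' : ∀ d, ∀ u ∈ 𝒰, ∀ x, inner ℝ (A d u x) x ≤ hi * ‖x‖ ^ 2)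
    {a : Fin 2 → Fin 2 → Euc p → ℝ} (hac : ∀ d z, ContinuousOn (a d z) 𝒰)
    (ha : ∀ d z, ∀ u ∈ 𝒰, 0 ≤ a d z u)
    (hpos : ∀ᵐ u ∂volume.restrict 𝒰, 0 < min (a 0 0 u) (a 1 1 u))
    {κ : ℝ} (hκ : 0 ≤ κ) (hκ1 : κ < 1)
    (hweight : ∀ u ∈ 𝒰, hi / lo * (a 1 0 u + a 0 1 u) ^ 2 ≤ 4 * κ ^ 2 * (a 0 0 u * a 1 1 u))
    {K M : ℝ} (hK : 0 < K) (hM0 : 0 < M) :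
    ∃ ε > 0, ∀ α : ℝ, 0 < α → α < ε → ∀ (h T : Struct p) (ψ : Fin 2 → Euc p → ℝ),
      (∀ z, ∀ x ∈ 𝒰, HasFDerivWithinAt (ψ z) (innerSL ℝ (h z x)) 𝒰 x) →
      (∀ d, ∀ x ∈ 𝒰, ∀ y ∈ 𝒰, ‖h d x - h d y‖ ≤ K * ‖x - y‖) →
      (∀ d, ∀ x ∈ 𝒰, ‖h d x‖ ≤ M) →
      (∀ d, MapsTo (T d) 𝒰 𝒰) → (∀ d, ContinuousOn (T d) 𝒰) →
      (∀ d, ∀ u ∈ 𝒰, Q d (T d u) + α • h d (T d u) = Q d u) →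
      (∀ z, ∑ d, ∫ u in 𝒰, (ψ z u - ψ z (T d u)) * a d z u = 0) →
      ∀ d, ∀ u ∈ 𝒰, ‖h d u‖ < 1 / 2 := by
  have hminc : ContinuousOn (fun u => min (a 0 0 u) (a 1 1 u)) 𝒰 := (hac 0 0).inf (hac 1 1)
  -- Over a distance `1 / (4 K)` a `K`-Lipschitz field varies by at most `1 / 4`, so a value of norm
  -- `1 / 2` leaves norm at least `1 / 4` on the ball.
  obtain ⟨c, hc, hball⟩ := exists_lower_bound_ball hcomp hconv hInt hminc
    (fun u hu => le_min (ha 0 0 u hu) (ha 1 1 u hu)) hpos (δ := 1 / (4 * K)) (by positivity)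
  set θ := (1 - κ) * lo / (2 * hi ^ 2) with hθ
  have hθ0 : 0 < θ := by
    have : 0 < 1 - κ := sub_pos.2 hκ1
    positivity
  set I : Fin 2 → Fin 2 → ℝ := fun d z => ∫ u in 𝒰, a d z u with hI
  have hI0 : ∀ d z, 0 ≤ I d z := fun d z => setIntegral_nonneg hcomp.measurableSet (ha d z)
  set W := M / lo with hW
  have hW0 : 0 < W := by positivity
  -- All error terms together are at most `C * t`, once both `α` and the oscillation of `A` are at
  -- most `t ≤ 1`.
  set C := θ * (4 * ((1 + K) * W) ^ 2 * I 0 0) +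
    (K * W ^ 2 + (1 + K) * W * W) * ∑ z, ∑ d, I d z with hC
  have hC0 : 0 ≤ C := by
    have : 0 ≤ ∑ z, ∑ d, I d z :=
      Finset.sum_nonneg fun z _ => Finset.sum_nonneg fun d _ => hI0 d z
    have := hI0 0 0
    positivity
  obtain ⟨t, ht0, ht1, htC⟩ : ∃ t : ℝ, 0 < t ∧ t ≤ 1 ∧ C * t < θ * (c / 16) := by
    refine ⟨min 1 (θ * (c / 16) / (C + 1)), by positivity, min_le_left _ _, ?_⟩
    have h1 : min 1 (θ * (c / 16) / (C + 1)) * (C + 1) ≤ θ * (c / 16) := by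
      rw [← le_div_iff₀ (by positivity)]
      exact min_le_right _ _
    have h2 : 0 < min 1 (θ * (c / 16) / (C + 1)) := by positivity
    nlinarith
  have hmod := fun d => exists_modulus hcomp (hAc d) ht0
  choose r hr hmod using hmod
  set ρ := min (r 0) (r 1) with hρ
  have hρ0 : 0 < ρ := lt_min (hr 0) (hr 1)
  have hρr : ∀ d, ρ ≤ r d := by
    intro d
    fin_cases d
    exacts [min_le_left _ _, min_le_right _ _]
  -- The bound `ρ / W` keeps the displacement `α W` within the range where `A` oscillates by at most
  -- `t`.
  refine ⟨min t (ρ / W), by positivity, ?_⟩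
  intro α hα hαε h T ψ hψ hLip hM hTm hTc hT hzero d₀ u₀ hu₀
  by_contra hlarge
  rw [not_lt] at hlarge
  have hαt : α ≤ t := (hαε.trans_le (min_le_left _ _)).le
  have hαρ : α * W ≤ ρ := by
    rw [← le_div_iff₀ hW0]
    exact (hαε.trans_le (min_le_right _ _)).le
  have hhc : ∀ d, ContinuousOn (h d) 𝒰 := fun d =>
    (LipschitzOnWith.of_dist_le_mul (K := ⟨K, hK.le⟩) fun x hx y hy => by
      rw [dist_eq_norm, dist_eq_norm]; exact hLip d x hx y hy).continuousOn
  have hψc : ∀ z, ContinuousOn (ψ z) 𝒰 := fun z x hx => (hψ z x hx).continuousWithinAt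
  set G : Euc p → ℝ := fun u => min (a 0 0 u) (a 1 1 u) * (‖h 0 u‖ ^ 2 + ‖h 1 u‖ ^ 2) with hG
  have hGc : ContinuousOn G 𝒰 := hminc.mul (((hhc 0).norm.pow 2).add ((hhc 1).norm.pow 2))
  have hG0 : ∀ u ∈ 𝒰, 0 ≤ G u := fun u hu =>
    mul_nonneg (le_min (ha 0 0 u hu) (ha 1 1 u hu)) (by positivity)
  have hlower : c / 16 ≤ ∫ u in 𝒰, G u := by
    have hms : MeasurableSet (Metric.ball u₀ (1 / (4 * K)) ∩ 𝒰) :=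
      Metric.isOpen_ball.measurableSet.inter hcomp.measurableSet
    calc c / 16 ≤ (∫ u in Metric.ball u₀ (1 / (4 * K)) ∩ 𝒰, min (a 0 0 u) (a 1 1 u)) * (1 / 16) := by
          linarith [hball u₀ hu₀]
      _ = ∫ u in Metric.ball u₀ (1 / (4 * K)) ∩ 𝒰, min (a 0 0 u) (a 1 1 u) * (1 / 16) :=
          (integral_mul_const _ _).symm
      _ ≤ ∫ u in Metric.ball u₀ (1 / (4 * K)) ∩ 𝒰, G u := by
          refine setIntegral_mono_on
            (((hminc.mul_const _).integrableOn_compact hcomp).mono_set inter_subset_right)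
            ((hGc.integrableOn_compact hcomp).mono_set inter_subset_right) hms fun u hu => ?_
          refine mul_le_mul_of_nonneg_left ?_ (le_min (ha 0 0 u hu.2) (ha 1 1 u hu.2))
          have h1 : ‖h d₀ u₀ - h d₀ u‖ ≤ 1 / 4 := by
            refine (hLip d₀ u₀ hu₀ u hu.2).trans ?_
            have := hu.1
            rw [Metric.mem_ball, dist_comm, dist_eq_norm, lt_div_iff₀ (by positivity)] at this
            linarith
          have h2 : 1 / 4 ≤ ‖h d₀ u‖ := by
            have := norm_sub_norm_le (h d₀ u₀) (h d₀ u)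
            linarith
          have h3 : 1 / 16 ≤ ‖h d₀ u‖ ^ 2 := by nlinarith
          have h4 : ‖h d₀ u‖ ^ 2 ≤ ‖h 0 u‖ ^ 2 + ‖h 1 u‖ ^ 2 := by
            fin_cases d₀
            · simp
            · simp
          exact h3.trans h4
      _ ≤ ∫ u in 𝒰, G u := by
          refine setIntegral_mono_set (hGc.integrableOn_compact hcomp) ?_
            inter_subset_right.eventuallyLE
          filter_upwards [ae_restrict_mem hcomp.measurableSet] with u hu using hG0 u hu
  set s := K * α * W ^ 2 + (t + K * α) * W * W with hsdef
  have hpt : ∀ u ∈ 𝒰, θ * G u ≤ θ * (4 * ((t + K * α) * W) ^ 2 * a 0 0 u) +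
      ∑ z, ∑ d, (α⁻¹ * ((ψ z u - ψ z (T d u)) * a d z u) + s * a d z u) := fun u hu =>
    increment_lower_bound hconv hQ hs hlo hhi hA hA' (fun d z => ha d z u hu) hκ hκ1.le
      (hweight u hu) hα ht0.le hK.le
      (fun d x hx y hy hxy => hmod d x hx y hy (hxy.trans (hρr d))) hαρ hψ hLip hM hu
      (fun d => hTm d hu) (fun d => hT d u hu)
  have hi1 : ∀ d z, IntegrableOn (fun u => (ψ z u - ψ z (T d u)) * a d z u) 𝒰 := fun d z =>
    (((hψc z).sub ((hψc z).comp (hTc d) (hTm d))).mul (hac d z)).integrableOn_compact hcomp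
  have hi2 : ∀ d z, IntegrableOn (a d z) 𝒰 := fun d z => (hac d z).integrableOn_compact hcomp
  have hi3 : ∀ d z, IntegrableOn (fun u => α⁻¹ * ((ψ z u - ψ z (T d u)) * a d z u) +
      s * a d z u) 𝒰 := fun d z => ((hi1 d z).const_mul _).add ((hi2 d z).const_mul _)
  -- The moment restrictions kill the increments of the potentials, however large `α⁻¹` is; only the
  -- errors survive.
  have hsum : ∫ u in 𝒰, ∑ z, ∑ d, (α⁻¹ * ((ψ z u - ψ z (T d u)) * a d z u) + s * a d z u) =
      s * ∑ z, ∑ d, I d z := by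
    rw [integral_finsetSum _ fun z _ => integrable_finsetSum _ fun d _ => hi3 d z, Finset.mul_sum]
    refine Finset.sum_congr rfl fun z _ => ?_
    rw [integral_finsetSum _ fun d _ => hi3 d z, Finset.mul_sum]
    simp_rw [integral_add ((hi1 _ z).const_mul _) ((hi2 _ z).const_mul _), integral_const_mul]
    rw [Finset.sum_add_distrib, ← Finset.mul_sum, hzero z]
    simp [hI]
  have hupper : θ * ∫ u in 𝒰, G u ≤
      θ * (4 * ((t + K * α) * W) ^ 2 * I 0 0) + s * ∑ z, ∑ d, I d z := by
    rw [← hsum, ← integral_const_mul, hI]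
    simp only
    rw [← integral_const_mul, ← integral_const_mul, ← integral_add]
    · exact setIntegral_mono_on ((hGc.integrableOn_compact hcomp).const_mul _)
        ((((hi2 0 0).const_mul _).const_mul _).add
          (integrable_finsetSum _ fun z _ => integrable_finsetSum _ fun d _ => hi3 d z))
        hcomp.measurableSet hpt
    · exact ((hi2 0 0).const_mul _).const_mul _
    · exact integrable_finsetSum _ fun z _ => integrable_finsetSum _ fun d _ => hi3 d z
  have hb1 : t + K * α ≤ (1 + K) * t := by nlinarith
  have hb2 : ((t + K * α) * W) ^ 2 ≤ ((1 + K) * W) ^ 2 * t := by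
    calc ((t + K * α) * W) ^ 2 ≤ ((1 + K) * t * W) ^ 2 := by gcongr
      _ = ((1 + K) * W) ^ 2 * (t * t) := by ring
      _ ≤ ((1 + K) * W) ^ 2 * t := by
          gcongr
          nlinarith
  have hb3 : s ≤ (K * W ^ 2 + (1 + K) * W * W) * t := by
    calc s ≤ K * t * W ^ 2 + (1 + K) * t * W * W := by
          rw [hsdef]; gcongr
      _ = _ := by ring
  have hfinal : θ * (c / 16) ≤ C * t := by
    calc θ * (c / 16) ≤ θ * ∫ u in 𝒰, G u := by gcongr
      _ ≤ _ := hupper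
      _ ≤ θ * (4 * (((1 + K) * W) ^ 2 * t) * I 0 0) +
          ((K * W ^ 2 + (1 + K) * W * W) * t) * ∑ z, ∑ d, I d z := by
          have := hI0 0 0
          have : 0 ≤ ∑ z, ∑ d, I d z :=
            Finset.sum_nonneg fun z _ => Finset.sum_nonneg fun d _ => hI0 d z
          gcongr
      _ = C * t := by rw [hC]; ring
  linarith

/-! ### Change of variables and integration against rank laws -/

/-- The bad set has null image under `g`, and a Jacobian bounded below forces it to be null itself.
-/
theorem ae_pos_comp {p : ℕ} {K S : Set (Euc p)} (hK : MeasurableSet K) {g : Euc p → Euc p}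
    (hinj : InjOn g K) {A : Euc p → Euc p →L[ℝ] Euc p}
    (hA : ∀ u ∈ K, HasFDerivWithinAt g (A u) K u) {k : ℝ} (hk : 0 < k)
    (hdet : ∀ u ∈ K, k ≤ |(A u).det|) (hS : MeasurableSet S) (hKS : MapsTo g K S) {f : Euc p → ℝ}
    (hf : ContinuousOn f S) (hpos : ∀ᵐ y ∂volume.restrict S, 0 < f y) :
    ∀ᵐ u ∂volume.restrict K, 0 < f (g u) := by
  have hgc : ContinuousOn g K := fun u hu => (hA u hu).continuousWithinAt
  have hB : MeasurableSet (K ∩ (f ∘ g) ⁻¹' Iic 0) :=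
    measurableSet_inter_preimage (hf.comp hgc hKS) hK measurableSet_Iic
  have himg := lintegral_abs_det_fderiv_eq_addHaar_image volume hB
    (fun u hu => (hA u hu.1).mono inter_subset_left) (hinj.mono inter_subset_left)
  have hnull : volume (g '' (K ∩ (f ∘ g) ⁻¹' Iic 0)) = 0 := by
    rw [ae_restrict_iff' hS, ae_iff] at hpos
    refine measure_mono_null ?_ hpos
    rintro _ ⟨u, hu, rfl⟩
    simp only [Classical.not_imp, mem_ofPred_eq]
    exact ⟨hKS hu.1, not_lt.2 hu.2⟩
  rw [hnull] at himg
  have hle : ENNReal.ofReal k * volume (K ∩ (f ∘ g) ⁻¹' Iic 0) ≤ 0 := by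
    rw [← himg, ← setLIntegral_const]
    exact setLIntegral_mono' hB fun u hu => ENNReal.ofReal_le_ofReal (hdet u hu.1)
  have h0 : volume (K ∩ (f ∘ g) ⁻¹' Iic 0) = 0 := by
    rcases mul_eq_zero.1 (le_antisymm hle zero_le) with h | h
    · exact absurd (ENNReal.ofReal_eq_zero.1 h) (not_le.2 hk)
    · exact h
  rw [ae_restrict_iff' hK, ae_iff]
  refine measure_mono_null (fun u hu => ?_) h0
  simp only [Classical.not_imp, mem_ofPred_eq] at hu
  exact ⟨hu.1, not_lt.1 hu.2⟩

theorem integrable_of_continuousOn {p : ℕ} {K : Set (Euc p)} (hK : IsCompact K)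
    {ν : Measure (Euc p)} [IsFiniteMeasure ν] (hν : ν Kᶜ = 0) {φ : Euc p → ℝ}
    (hφ : ContinuousOn φ K) : Integrable φ ν := by
  have h := hφ.integrableOn_compact (μ := ν) hK
  rwa [IntegrableOn, Measure.restrict_eq_self_of_ae_mem (mem_ae_iff.2 hν)] at h

theorem aemeasurable_of_continuousOn {p : ℕ} {K : Set (Euc p)} (hK : MeasurableSet K)
    {ν : Measure (Euc p)} (hν : ν Kᶜ = 0) {T : Euc p → Euc p} (hT : ContinuousOn T K) :
    AEMeasurable T ν := by
  have h := hT.aemeasurable (μ := ν) hK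
  rwa [Measure.restrict_eq_self_of_ae_mem (mem_ae_iff.2 hν)] at h

/-! ### Two models with the same observed law -/

section TwoModels

variable {p : ℕ} {𝒰 : Set (Euc p)} {μ : Measure (Euc p)}
  {Ω : Type u} [MeasurableSpace Ω] {P : Measure Ω}
  {Y : Fin 2 → Ω → Euc p} {D Z : Ω → Fin 2} {U : Fin 2 → Ω → Euc p} {q : Struct p}
  {Ω' : Type v} [MeasurableSpace Ω'] {P' : Measure Ω'}
  {Y' : Fin 2 → Ω' → Euc p} {D' Z' : Ω' → Fin 2} {U' : Fin 2 → Ω' → Euc p} {q' : Struct p}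

/-- If two models generate the same observed law and the first has a positive density of ranks,
then the outcomes of the first model lie in the range of the structural function of the second. -/
theorem Model.image_subset_image (h : Model 𝒰 μ q P Y D Z U) (h' : Model 𝒰 μ q' P' Y' D' Z' U')
    (hL : obsLaw P' Y' D' Z' = obsLaw P Y D Z) (hμ : μ 𝒰ᶜ = 0) (hU : IsCompact 𝒰)
    (hconv : Convex ℝ 𝒰) (hInt : (interior 𝒰).Nonempty) {d z : Fin 2} {a : Euc p → ℝ}
    (ha : rankLaw P D Z U d z = (volume.restrict 𝒰).withDensity fun u => ENNReal.ofReal (a u))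
    (hac : ContinuousOn a 𝒰) (hapos : ∀ᵐ u ∂volume.restrict 𝒰, 0 < a u)
    (hc : ContinuousOn (q d) 𝒰) (hc' : ContinuousOn (q' d) 𝒰) :
    MapsTo (q d) 𝒰 (q' d '' 𝒰) := by
  intro u hu
  by_contra hout
  have hclosed : IsClosed (q' d '' 𝒰) := (hU.image_of_continuousOn hc').isClosed
  -- The range of `q' d` is closed, so the ranks sent outside it form a relatively open set. The
  -- second model gives its outcomes no mass, while the positive density `a` does.
  obtain ⟨O, hO, hOS⟩ := continuousOn_iff'.1 hc _ hclosed.isOpen_compl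
  have hSpos : 0 < volume (O ∩ 𝒰) :=
    measure_inter_pos volume hconv hInt hO ⟨u, hOS.subset ⟨hout, hu⟩⟩
  have h0 : rankLaw P D Z U d z (O ∩ 𝒰) = 0 := by
    rw [← hOS, inter_comm, ← h.obsCond_eq_rankLaw hμ hU.measurableSet d z hc
      hclosed.measurableSet.compl, ← hL, h'.obsCond_eq_rankLaw hμ hU.measurableSet d z hc'
      hclosed.measurableSet.compl]
    convert measure_empty (μ := rankLaw P' D' Z' U' d z)
    ext x
    simp only [mem_inter_iff, mem_preimage, mem_compl_iff, mem_empty_iff_false, iff_false, not_and,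
      not_not]
    exact fun hx => mem_image_of_mem _ hx
  have hOm : MeasurableSet (O ∩ 𝒰) := hO.measurableSet.inter hU.measurableSet
  rw [ha, withDensity_apply _ hOm, Measure.restrict_restrict hOm,
    inter_eq_left.2 inter_subset_right, lintegral_eq_zero_iff'] at h0
  · have hpos' := ae_restrict_of_ae_restrict_of_subset inter_subset_right hapos (s := O ∩ 𝒰)
    have hF : ∀ᵐ x ∂volume.restrict (O ∩ 𝒰), False := by
      filter_upwards [h0, hpos'] with x hx hx'
      exact absurd (ENNReal.ofReal_eq_zero.1 hx) (not_le.2 hx')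
    rw [ae_iff] at hF
    simp only [not_false_eq_true, ofPred_true, Measure.restrict_apply_univ] at hF
    exact hSpos.ne' hF
  · exact ((hac.mono inter_subset_right).aemeasurable hOm).ennreal_ofReal

/-- Both rank laws are read off the same observed law; since `q' d` is injective, `q d u ∈ q' d ''
B` amounts to `T u ∈ B` for `B ⊆ 𝒰`. -/
theorem Model.rankLaw_eq_map [IsProbabilityMeasure P] [IsProbabilityMeasure P']
    (h : Model 𝒰 μ q P Y D Z U) (h' : Model 𝒰 μ q' P' Y' D' Z' U')
    (hL : obsLaw P' Y' D' Z' = obsLaw P Y D Z) (hμ : μ 𝒰ᶜ = 0) (hU : MeasurableSet 𝒰)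
    (d : Fin 2) {z : Fin 2} (hz : P (Z ⁻¹' {z}) ≠ 0) (hz' : P' (Z' ⁻¹' {z}) ≠ 0)
    (hc : ContinuousOn (q d) 𝒰) (hc' : ContinuousOn (q' d) 𝒰) (hinj' : InjOn (q' d) 𝒰)
    {T : Euc p → Euc p} (hTm : MapsTo T 𝒰 𝒰) (hTc : ContinuousOn T 𝒰)
    (hT : ∀ u ∈ 𝒰, q' d (T u) = q d u) :
    rankLaw P' D' Z' U' d z = (rankLaw P D Z U d z).map T := by
  have h0 : rankLaw P D Z U d z 𝒰ᶜ = 0 :=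
    le_antisymm ((h.rankLaw_le d hz 𝒰ᶜ).trans hμ.le) zero_le
  have h0' : rankLaw P' D' Z' U' d z 𝒰ᶜ = 0 :=
    le_antisymm ((h'.rankLaw_le d hz' 𝒰ᶜ).trans hμ.le) zero_le
  ext B hB
  rw [Measure.map_apply_of_aemeasurable (aemeasurable_of_continuousOn hU h0 hTc) hB,
    ← measure_inter_conull h0', ← measure_inter_conull h0]
  have hBU : MeasurableSet (B ∩ 𝒰) := hB.inter hU
  rw [h'.rankLaw_eq_obsCond_image hμ hU d z hc' hinj' hBU inter_subset_right, hL,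
    h.obsCond_eq_rankLaw hμ hU d z hc (hBU.image_of_continuousOn_injOn
      (hc'.mono inter_subset_right) (hinj'.mono inter_subset_right))]
  congr 1
  ext u
  simp only [mem_inter_iff, mem_preimage]
  constructor
  · rintro ⟨hu, hq⟩
    rw [← hT u hu, hinj'.mem_image_iff inter_subset_right (hTm hu)] at hq
    exact ⟨hq.1, hu⟩
  · rintro ⟨hB', hu⟩
    refine ⟨hu, ?_⟩
    rw [← hT u hu]
    exact mem_image_of_mem _ ⟨hB', hTm hu⟩

/-- Moment restrictions: the total law of the ranks does not change under the transport maps. -/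
theorem Model.sum_integral_eq_zero [IsProbabilityMeasure μ] [IsProbabilityMeasure P]
    [IsProbabilityMeasure P'] (h : Model 𝒰 μ q P Y D Z U)
    (h' : Model 𝒰 μ q' P' Y' D' Z' U')
    (hL : obsLaw P' Y' D' Z' = obsLaw P Y D Z) (hμ : μ 𝒰ᶜ = 0) (hU : IsCompact 𝒰)
    {z : Fin 2} (hz : P (Z ⁻¹' {z}) ≠ 0) (hz' : P' (Z' ⁻¹' {z}) ≠ 0)
    (hc : ∀ d, ContinuousOn (q d) 𝒰) (hc' : ∀ d, ContinuousOn (q' d) 𝒰)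
    (hinj' : ∀ d, InjOn (q' d) 𝒰) {T : Struct p} (hTm : ∀ d, MapsTo (T d) 𝒰 𝒰)
    (hTc : ∀ d, ContinuousOn (T d) 𝒰) (hT : ∀ d, ∀ u ∈ 𝒰, q' d (T d u) = q d u)
    {a : Fin 2 → Euc p → ℝ}
    (ha : ∀ d, rankLaw P D Z U d z =
      (volume.restrict 𝒰).withDensity fun u => ENNReal.ofReal (a d u))
    (hac : ∀ d, ContinuousOn (a d) 𝒰) (ha0 : ∀ d, ∀ u ∈ 𝒰, 0 ≤ a d u) {φ : Euc p → ℝ}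
    (hφ : ContinuousOn φ 𝒰) :
    ∑ d, ∫ u in 𝒰, (φ u - φ (T d u)) * a d u = 0 := by
  have hfin : ∀ d, IsFiniteMeasure (rankLaw P D Z U d z) := fun d =>
    isFiniteMeasure_of_le μ (h.rankLaw_le d hz)
  have hfin' : ∀ d, IsFiniteMeasure (rankLaw P' D' Z' U' d z) := fun d =>
    isFiniteMeasure_of_le μ (h'.rankLaw_le d hz')
  have h0 : ∀ d, rankLaw P D Z U d z 𝒰ᶜ = 0 := fun d =>
    le_antisymm ((h.rankLaw_le d hz 𝒰ᶜ).trans hμ.le) zero_le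
  have h0' : ∀ d, rankLaw P' D' Z' U' d z 𝒰ᶜ = 0 := fun d =>
    le_antisymm ((h'.rankLaw_le d hz' 𝒰ᶜ).trans hμ.le) zero_le
  have hInt : ∀ d, Integrable φ (rankLaw P D Z U d z) := fun d =>
    integrable_of_continuousOn hU (h0 d) hφ
  have hInt' : ∀ d, Integrable φ (rankLaw P' D' Z' U' d z) := fun d =>
    integrable_of_continuousOn hU (h0' d) hφ
  have hintT : ∀ d, Integrable (fun u => φ (T d u)) (rankLaw P D Z U d z) := fun d =>
    integrable_of_continuousOn hU (h0 d) (hφ.comp (hTc d) (hTm d))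
  have hmap : ∀ d, ∫ u, φ u ∂(rankLaw P' D' Z' U' d z) =
      ∫ u, φ (T d u) ∂(rankLaw P D Z U d z) := by
    intro d
    have hm := h.rankLaw_eq_map h' hL hμ hU.measurableSet d hz hz' (hc d) (hc' d) (hinj' d)
      (hTm d) (hTc d) (hT d)
    have hi := (hInt' d).aestronglyMeasurable
    rw [hm] at hi ⊢
    exact integral_map (aemeasurable_of_continuousOn hU.measurableSet (h0 d) (hTc d)) hi
  have hden : ∀ d, ∀ g : Euc p → ℝ, ∫ u, g u ∂(rankLaw P D Z U d z) =
      ∫ u in 𝒰, g u * a d u := by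
    intro d g
    rw [ha, integral_withDensity_eq_integral_toReal_smul₀
      ((hac d).aemeasurable hU.measurableSet).ennreal_ofReal
      (Eventually.of_forall fun _ => ENNReal.ofReal_lt_top)]
    refine setIntegral_congr_fun hU.measurableSet fun u hu => ?_
    simp only [ENNReal.toReal_ofReal (ha0 d u hu), smul_eq_mul, mul_comm]
  -- Both models decompose the same `μ`; comparing the decompositions gives the restriction.
  have h1 : ∫ u, φ u ∂μ = ∫ u, φ u ∂(rankLaw P D Z U 0 z) + ∫ u, φ u ∂(rankLaw P D Z U 1 z) := by
    rw [← integral_add_measure (hInt 0) (hInt 1), h.rankLaw_add hz]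
  have h2 : ∫ u, φ u ∂μ =
      ∫ u, φ u ∂(rankLaw P' D' Z' U' 0 z) + ∫ u, φ u ∂(rankLaw P' D' Z' U' 1 z) := by
    rw [← integral_add_measure (hInt' 0) (hInt' 1), h'.rankLaw_add hz']
  simp_rw [← hden]
  rw [Fin.sum_univ_two, integral_sub (hInt 0) (hintT 0), integral_sub (hInt 1) (hintT 1)]
  rw [hmap, hmap] at h2
  linarith

end TwoModels

/-! ### Norms, transports and derivatives in the parameter space -/

section ParameterSpace

variable {p : ℕ} {𝒰 : Set (Euc p)}

theorem abs_le_normQ (hU : IsCompact 𝒰) {q : Struct p} (hq : ∀ d, ContinuousOn (q d) 𝒰)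
    (d : Fin 2) (i : Fin p) {u : Euc p} (hu : u ∈ 𝒰) : |q d u i| ≤ normQ 𝒰 q := by
  have hb : BddAbove (range fun u : 𝒰 => |q d u i|) := by
    have hc : ContinuousOn (fun u => |q d u i|) 𝒰 :=
      ((EuclideanSpace.proj (𝕜 := ℝ) i).continuous.comp_continuousOn (hq d)).abs
    have := (hU.image_of_continuousOn hc).bddAbove
    rwa [image_eq_range] at this
  calc |q d u i| ≤ ⨆ u : 𝒰, |q d u i| := le_ciSup hb ⟨u, hu⟩
    _ ≤ ⨆ i : Fin p, ⨆ u : 𝒰, |q d u i| :=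
        le_ciSup (f := fun i : Fin p => ⨆ u : 𝒰, |q d u i|) (finite_range _).bddAbove i
    _ ≤ _ := le_ciSup (f := fun d : Fin 2 => ⨆ i : Fin p, ⨆ u : 𝒰, |q d u i|)
        (finite_range _).bddAbove d

theorem exists_le_abs_of_lt_normQ {q : Struct p} {c : ℝ} (hc : 0 ≤ c) (h : c < normQ 𝒰 q) :
    ∃ d i, ∃ u ∈ 𝒰, c ≤ |q d u i| := by
  by_contra! hcon
  exact absurd h (not_lt.2 (Real.iSup_le (fun d => Real.iSup_le (fun i =>
    Real.iSup_le (fun u => (hcon d i u u.2).le) hc) hc) hc))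

/-- Continuity on a compact set supplies the upper bound without which the real supremum would take
its default value `0`. -/
theorem norm_derivOn_le_supOpNorm (hU : IsCompact 𝒰) {M : Euc p → Euc p →L[ℝ] Euc p}
    (hM : ContinuousOn M 𝒰) {u : Euc p} (hu : u ∈ 𝒰) : ‖M u‖ ≤ supOpNorm 𝒰 M := by
  have := (hU.image_of_continuousOn hM.norm).bddAbove
  rw [image_eq_range] at this
  exact le_ciSup (f := fun u : 𝒰 => ‖M u‖) this ⟨u, hu⟩

theorem norm_le_of_abs_le {x : Euc p} (hx : ∀ i, |x i| ≤ 1) : ‖x‖ ≤ Real.sqrt p := by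
  rw [EuclideanSpace.norm_eq]
  refine Real.sqrt_le_sqrt ?_
  calc ∑ i, ‖x i‖ ^ 2 ≤ ∑ _i : Fin p, (1 : ℝ) :=
        Finset.sum_le_sum fun i _ => pow_le_one₀ (norm_nonneg _) (hx i)
    _ = p := by simp

theorem injOn_of_lower_bound {q : Euc p → Euc p} {A : Euc p → Euc p →L[ℝ] Euc p}
    (hconv : Convex ℝ 𝒰) (hq : ∀ u ∈ 𝒰, HasFDerivWithinAt q (A u) 𝒰 u) {lo : ℝ} (hlo : 0 < lo)
    (hA : ∀ u ∈ 𝒰, ∀ x, lo * ‖x‖ ^ 2 ≤ inner ℝ (A u x) x) : InjOn q 𝒰 := by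
  intro u hu v hv huv
  have := strong_monotone hconv hq hA hu hv
  rw [huv, sub_self, norm_zero] at this
  have h0 : ‖u - v‖ ≤ 0 := by nlinarith [norm_nonneg (u - v)]
  exact sub_eq_zero.1 (norm_le_zero_iff.1 h0)

/-- The transport `q'⁻¹ ∘ q` is continuous. -/
theorem exists_transport {q q' : Euc p → Euc p} {A' : Euc p → Euc p →L[ℝ] Euc p}
    (hconv : Convex ℝ 𝒰) (hq' : ∀ u ∈ 𝒰, HasFDerivWithinAt q' (A' u) 𝒰 u) {lo : ℝ} (hlo : 0 < lo)
    (hA' : ∀ u ∈ 𝒰, ∀ x, lo * ‖x‖ ^ 2 ≤ inner ℝ (A' u x) x) (hc : ContinuousOn q 𝒰)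
    (hsub : MapsTo q 𝒰 (q' '' 𝒰)) :
    ∃ T : Euc p → Euc p, MapsTo T 𝒰 𝒰 ∧ ContinuousOn T 𝒰 ∧ ∀ u ∈ 𝒰, q' (T u) = q u := by
  have hex : ∀ u, u ∈ 𝒰 → ∃ v, v ∈ 𝒰 ∧ q' v = q u := fun u hu => hsub hu
  choose! T hTm hT using hex
  refine ⟨T, fun u hu => hTm u hu, ?_, hT⟩
  intro u hu
  have h1 : Tendsto (fun v => lo⁻¹ * ‖q v - q u‖) (𝓝[𝒰] u) (𝓝 0) := by
    have := ((hc u hu).sub_const (q u)).norm.const_mul lo⁻¹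
    simpa [ContinuousWithinAt] using this
  refine tendsto_iff_norm_sub_tendsto_zero.2 (squeeze_zero' (Eventually.of_forall fun _ => norm_nonneg _)
    ?_ h1)
  filter_upwards [self_mem_nhdsWithin] with v hv
  -- The inverse of `q'` is Lipschitz with constant `lo⁻¹`.
  have := strong_monotone hconv hq' hA' (hTm v hv) (hTm u hu)
  rw [hT v hv, hT u hu] at this
  rw [inv_mul_eq_div, le_div_iff₀ hlo, mul_comm]
  exact this

end ParameterSpace

/-- Derivatives within a convex body are unique, also at boundary points. -/
theorem derivOn_add_smul {p : ℕ} {𝒰 : Set (Euc p)} (hconv : Convex ℝ 𝒰) (hclosed : IsClosed 𝒰)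
    (hInt : (interior 𝒰).Nonempty) {f g h : Euc p → Euc p} (hf : IsCk 2 𝒰 f) (hg : IsCk 2 𝒰 g)
    (hh : IsCk 2 𝒰 h) {α : ℝ} (heq : ∀ u ∈ 𝒰, f u = g u + α • h u) {u : Euc p} (hu : u ∈ 𝒰) :
    derivOn 𝒰 f u = derivOn 𝒰 g u + α • derivOn 𝒰 h u := by
  have h1 := hf.hasFDerivWithinAt_derivOn one_le_two hconv hclosed hInt hu
  have h2 := ((hg.hasFDerivWithinAt_derivOn one_le_two hconv hclosed hInt hu).add
    ((hh.hasFDerivWithinAt_derivOn one_le_two hconv hclosed hInt hu).const_smul α))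
  exact (uniqueDiffOn_convex hconv hInt u hu).eq h1 (h2.congr heq (heq u hu))

/-- Passes symmetry from `Dq` and `Dq*` to `Dh`, so that `h` has a potential. -/
theorem symm_of_add_smul {p : ℕ} {A B C : Euc p →L[ℝ] Euc p} {α : ℝ} (hα : α ≠ 0)
    (hA : ∀ x y, inner ℝ (A x) y = inner ℝ x (A y))
    (hB : ∀ x y, inner ℝ (B x) y = inner ℝ x (B y)) (hABC : A = B + α • C) (x y : Euc p) :
    inner ℝ (C x) y = inner ℝ x (C y) := by
  have h := hA x y
  rw [hABC] at h
  simp only [add_apply, smul_apply, inner_add_left,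
    inner_add_right, inner_smul_left, inner_smul_right, hB x y] at h
  exact mul_left_cancel₀ hα (add_left_cancel h)

end IVQ

/-! ### The identification theorem -/

theorem theorem3p1 {p : ℕ}
    -- the set of ranks and the reference measure
    (𝒰 : Set (IVQ.Euc p)) (hU_compact : IsCompact 𝒰) (hU_convex : Convex ℝ 𝒰)
    (hU_bdry : IVQ.HasPiecewiseBoundary 1 𝒰)
    (μ : Measure (IVQ.Euc p)) [IsProbabilityMeasure μ]
    (hμ_supp : μ.support = 𝒰) (hμ_ac : μ ≪ volume)
    -- the constants in the definition of the parameter set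
    (lo hi K : ℝ) (hlo : 0 < lo) (hlohi : lo < hi) (hK : 0 < K)
    -- the true model
    {Ω : Type u} [MeasurableSpace Ω] (P : Measure Ω) [IsProbabilityMeasure P]
    (Y : Fin 2 → Ω → IVQ.Euc p) (D Z : Ω → Fin 2) (U : Fin 2 → Ω → IVQ.Euc p)
    (qstar : IVQ.Struct p) (hmodel : IVQ.Model 𝒰 μ qstar P Y D Z U)
    (hZ : ∀ z : Fin 2, P (Z ⁻¹' {z}) ≠ 0)
    -- correct specification
    (hspec : qstar ∈ IVQ.Q0 𝒰 lo hi K qstar)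
    -- regular supports
    (hY : ∀ d, Convex ℝ (IVQ.suppY P Y d) ∧ IsCompact (IVQ.suppY P Y d) ∧
      IVQ.HasPiecewiseBoundary 2 (IVQ.suppY P Y d))
    -- continuously differentiable densities
    (f : Fin 2 → Fin 2 → IVQ.Euc p → ℝ)
    (hf : ∀ d z, IVQ.IsDensity P Y D Z d z (f d z))
    (hf_smooth : ∀ d z, IVQ.IsCk 1 (IVQ.suppY P Y d) (f d z))
    -- positive correlation of treatment and instrument
    (hpos : ∀ᵐ y : IVQ.Euc p × IVQ.Euc p
      ∂(volume.restrict (IVQ.suppY P Y 0 ×ˢ IVQ.suppY P Y 1)),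
      (hi / lo) ^ (p + 1) * (f 0 1 y.1 + f 1 0 y.2) ^ 2 < 4 * f 0 0 y.1 * f 1 1 y.2) :
    IVQ.IsLocallyIdentifiedIn.{v} 𝒰 μ (IVQ.obsLaw P Y D Z) qstar
      (IVQ.Q0 𝒰 lo hi K qstar) := by
  open IVQ Set in
  have hμ0 : μ 𝒰ᶜ = 0 := hμ_supp ▸ Measure.measure_compl_support
  have hUm : MeasurableSet 𝒰 := hU_compact.measurableSet
  have hUvol : volume 𝒰 ≠ 0 := by
    intro h0
    have h1 := measure_univ (μ := μ)
    rw [← measure_add_measure_compl hUm, hμ_ac h0, hμ0, add_zero] at h1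
    exact zero_ne_one h1
  have hInt : (interior 𝒰).Nonempty := interior_nonempty_of_measure_pos volume hU_convex hUvol
  have hclosed := hU_compact.isClosed
  have hhi : 0 < hi := hlo.trans hlohi
  have hder : ∀ {q : Struct p}, q ∈ tildeQ 𝒰 lo hi → ∀ d, ∀ u ∈ 𝒰,
      HasFDerivWithinAt (q d) (derivOn 𝒰 (q d) u) 𝒰 u := fun hq d u hu =>
    (hq.1 d).hasFDerivWithinAt_derivOn one_le_two hU_convex hclosed hInt hu
  have hbounds : ∀ {q : Struct p}, q ∈ tildeQ 𝒰 lo hi → ∀ d, ∀ u ∈ 𝒰, ∀ x,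
      inner ℝ (derivOn 𝒰 (q d) u x) x ≤ hi * ‖x‖ ^ 2 ∧
        (x ≠ 0 → lo * ‖x‖ ^ 2 < inner ℝ (derivOn 𝒰 (q d) u x) x) := fun hq d u hu x =>
    inner_apply_bounds (hq.2 d u hu).1.1 (hq.2 d u hu).2 x
  have hbound : ∀ {q : Struct p}, q ∈ tildeQ 𝒰 lo hi → ∀ d, ∀ u ∈ 𝒰, ∀ x,
      lo * ‖x‖ ^ 2 ≤ inner ℝ (derivOn 𝒰 (q d) u x) x := by
    intro q hq d u hu x
    by_cases hx : x = 0
    · simp [hx]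
    · exact ((hbounds hq d u hu x).2 hx).le
  have hinj : ∀ {q : Struct p}, q ∈ tildeQ 𝒰 lo hi → ∀ d, InjOn (q d) 𝒰 := fun hq d =>
    injOn_of_lower_bound hU_convex (hder hq d) hlo (hbound hq d)
  have hst := hspec.1
  have hAc : ∀ d, ContinuousOn (derivOn 𝒰 (qstar d)) 𝒰 := fun d =>
    (hst.1 d).continuousOn_derivOn one_le_two hU_convex hInt
  have hsymm : ∀ d, ∀ u ∈ 𝒰, ∀ x y, inner ℝ (derivOn 𝒰 (qstar d) u x) y =
      inner ℝ x (derivOn 𝒰 (qstar d) u y) := fun d u hu => (hst.2 d u hu).1.1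
  -- a uniform gap below the spectrum
  choose l hl hlA using fun d => exists_uniform_lower_bound hU_compact (hAc d)
    (fun u hu x => (hbounds hst d u hu x).2)
  obtain ⟨lo', hlo', hlo'hi, hA⟩ : ∃ lo', lo < lo' ∧ lo' ≤ hi ∧ ∀ d, ∀ u ∈ 𝒰, ∀ x,
      lo' * ‖x‖ ^ 2 ≤ inner ℝ (derivOn 𝒰 (qstar d) u x) x := by
    -- The cap at `hi` keeps `hi / lo' ≥ 1`, as `weighted_sum_bound` requires.
    refine ⟨min hi (min (l 0) (l 1)), lt_min hlohi (lt_min (hl 0) (hl 1)), min_le_left _ _,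
      fun d u hu x => le_trans ?_ (hlA d u hu x)⟩
    refine mul_le_mul_of_nonneg_right ((min_le_right _ _).trans ?_) (sq_nonneg _)
    fin_cases d
    exacts [min_le_left _ _, min_le_right _ _]
  have hlo'0 : 0 < lo' := hlo.trans hlo'
  have hA' : ∀ d, ∀ u ∈ 𝒰, ∀ x, inner ℝ (derivOn 𝒰 (qstar d) u x) x ≤ hi * ‖x‖ ^ 2 :=
    fun d u hu x => (hbounds hst d u hu x).1
  have hdet : ∀ d, ∀ u ∈ 𝒰, lo' ^ p ≤ |(derivOn 𝒰 (qstar d) u).det| ∧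
      |(derivOn 𝒰 (qstar d) u).det| ≤ hi ^ p := by
    intro d u hu
    have h1 := det_bounds (hsymm d u hu) hlo'0.le (hA d u hu) (hA' d u hu)
    rwa [abs_of_nonneg ((pow_pos hlo'0 p).le.trans h1.1)]
  have hcont : ∀ d, ContinuousOn (qstar d) 𝒰 := fun d => (hst.1 d).1
  have himg : ∀ d, MapsTo (qstar d) 𝒰 (suppY P Y d) := fun d u hu =>
    hmodel.image_subset_suppY hμ0 hUm hμ_supp d (hcont d) (mem_image_of_mem _ hu)
  -- the densities of the rank laws
  set a : Fin 2 → Fin 2 → Euc p → ℝ := fun d z u =>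
    f d z (qstar d u) * |(derivOn 𝒰 (qstar d) u).det|
  have hac : ∀ d z, ContinuousOn (a d z) 𝒰 := fun d z =>
    ((hf_smooth d z).1.comp (hcont d) (himg d)).mul
      (ContinuousLinearMap.continuous_det.comp_continuousOn (hAc d)).abs
  have ha0 : ∀ d z, ∀ u ∈ 𝒰, 0 ≤ a d z u := fun d z u hu =>
    mul_nonneg ((hf d z).1 _ (himg d hu)) (abs_nonneg _)
  have hrank : ∀ d z, rankLaw P D Z U d z =
      (volume.restrict 𝒰).withDensity fun u => ENNReal.ofReal (a d z u) := fun d z =>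
    hmodel.rankLaw_eq_withDensity hμ0 hUm hμ_supp d (hZ z) (hinj hst d) (hder hst d) (hf d z)
  -- the correlation condition
  have hYm : ∀ d, MeasurableSet (suppY P Y d) := fun d => (hY d).2.1.measurableSet
  -- The support contains the image of `𝒰`, whose volume is at least `lo' ^ p` times that of `𝒰`.
  have hYvol : ∀ d, volume (suppY P Y d) ≠ 0 := by
    intro d h0
    have h1 := lintegral_abs_det_fderiv_eq_addHaar_image volume hUm (hder hst d) (hinj hst d)
    rw [measure_mono_null (image_subset_iff.2 (himg d)) h0] at h1
    have h2 : ENNReal.ofReal (lo' ^ p) * volume 𝒰 ≤ 0 := by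
      rw [← h1, ← setLIntegral_const]
      exact setLIntegral_mono' hUm fun u hu => ENNReal.ofReal_le_ofReal (hdet d u hu).1
    rcases mul_eq_zero.1 (le_antisymm h2 zero_le) with h | h
    · exact absurd (ENNReal.ofReal_eq_zero.1 h) (not_le.2 (pow_pos hlo'0 p))
    · exact hUvol h
  have hYint : ∀ d, (interior (suppY P Y d)).Nonempty := fun d =>
    interior_nonempty_of_measure_pos volume (hY d).1 (hYvol d)
  have hfpos : (∀ᵐ y ∂volume.restrict (suppY P Y 0), 0 < f 0 0 y) ∧
      ∀ᵐ y ∂volume.restrict (suppY P Y 1), 0 < f 1 1 y := by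
    have hprod : ∀ᵐ y ∂((volume.restrict (suppY P Y 0)).prod (volume.restrict (suppY P Y 1))),
        0 < f 0 0 y.1 * f 1 1 y.2 := by
      rw [Measure.prod_restrict, ← Measure.volume_eq_prod]
      filter_upwards [hpos] with y hy
      have : 0 ≤ (hi / lo) ^ (p + 1) * (f 0 1 y.1 + f 1 0 y.2) ^ 2 := by positivity
      linarith
    have hne : ∀ d, (ae (volume.restrict (suppY P Y d))).NeBot := fun d =>
      ae_restrict_neBot.2 (hYvol d)
    constructor
    -- By Fubini almost every `y` has a partner `y'` with positive product; as the first factor is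
    -- nonnegative, it is positive.
    · filter_upwards [Measure.ae_ae_of_ae_prod hprod, ae_restrict_mem (hYm 0)] with y hy hyS
      have := hne 1
      obtain ⟨y', hy'⟩ := hy.exists
      exact lt_of_le_of_ne ((hf 0 0).1 y hyS) fun h => by rw [← h, zero_mul] at hy'; exact hy'.false
    · have hprod' := (Measure.measurePreserving_swap (μ := volume.restrict (suppY P Y 1))
        (ν := volume.restrict (suppY P Y 0))).quasiMeasurePreserving.ae hprod
      filter_upwards [Measure.ae_ae_of_ae_prod hprod', ae_restrict_mem (hYm 1)] with y hy hyS
      have := hne 0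
      obtain ⟨y', hy'⟩ := hy.exists
      refine lt_of_le_of_ne ((hf 1 1).1 y hyS) fun h => ?_
      simp only [Prod.swap_prod_mk, ← h, mul_zero] at hy'
      exact hy'.false
  have hapos : ∀ d, ∀ᵐ u ∂volume.restrict 𝒰, 0 < a d d u := by
    intro d
    have h1 : ∀ᵐ y ∂volume.restrict (suppY P Y d), 0 < f d d y := by
      fin_cases d
      exacts [hfpos.1, hfpos.2]
    filter_upwards [ae_pos_comp hUm (hinj hst d) (hder hst d) (pow_pos hlo'0 p)
      (fun u hu => (hdet d u hu).1) (hYm d) (himg d) (hf_smooth d d).1 h1,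
      ae_restrict_mem hUm] with u hu huU
    exact mul_pos hu ((pow_pos hlo'0 p).trans_le (hdet d u huU).1)
  -- Continuity gives the inequality everywhere, at the loss of strictness; the margin is recovered
  -- through `κ < 1`.
  have hweak : ∀ y ∈ suppY P Y 0 ×ˢ suppY P Y 1,
      0 ≤ 4 * f 0 0 y.1 * f 1 1 y.2 - (hi / lo) ^ (p + 1) * (f 0 1 y.1 + f 1 0 y.2) ^ 2 := by
    have h0 : ∀ z, ContinuousOn (fun y : Euc p × Euc p => f 0 z y.1)
        (suppY P Y 0 ×ˢ suppY P Y 1) := fun z =>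
      (hf_smooth 0 z).1.comp continuousOn_fst fun y hy => hy.1
    have h1 : ∀ z, ContinuousOn (fun y : Euc p × Euc p => f 1 z y.2)
        (suppY P Y 0 ×ˢ suppY P Y 1) := fun z =>
      (hf_smooth 1 z).1.comp continuousOn_snd fun y hy => hy.2
    refine forall_le_of_ae_prod (hY 0).1 (hY 1).1 (hYint 0) (hYint 1)
      ((((h0 0).const_mul 4).mul (h1 1)).sub ((((h0 1).add (h1 0)).pow 2).const_mul _)) ?_
    filter_upwards [hpos] with y hy using (sub_pos.2 hy).le
  set κ := Real.sqrt ((lo / lo') ^ (p + 1)) with hκ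
  have hκ1 : κ < 1 := by
    rw [hκ, Real.sqrt_lt' one_pos, one_pow]
    exact pow_lt_one₀ (by positivity) ((div_lt_one hlo'0).2 hlo') p.succ_ne_zero
  have hweight : ∀ u ∈ 𝒰,
      hi / lo' * (a 1 0 u + a 0 1 u) ^ 2 ≤ 4 * κ ^ 2 * (a 0 0 u * a 1 1 u) := fun u hu =>
    weighted_sum_bound hlo hlo' hlo'hi (hdet 0 u hu).1 (hdet 0 u hu).2 (hdet 1 u hu).1
      (hdet 1 u hu).2 ((hf 0 1).1 _ (himg 0 hu)) ((hf 1 0).1 _ (himg 1 hu))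
      (sub_nonneg.1 (hweak (qstar 0 u, qstar 1 u) ⟨himg 0 hu, himg 1 hu⟩))
  -- Here `√p` bounds the Euclidean norm of a vector with entries in `[-1, 1]`; adding `1` keeps `M`
  -- positive when `p = 0`.
  obtain ⟨ε, hε, hmain⟩ := exists_perturbation_radius hU_compact hU_convex hInt (hder hst) hAc hsymm
    hlo'0 hhi hA hA' hac ha0
      (by filter_upwards [hapos 0, hapos 1] with u h0 h1 using lt_min h0 h1)
      (Real.sqrt_nonneg _) hκ1 hweight hK (M := Real.sqrt p + 1) (by positivity)
  -- Some coordinate of `h` has absolute value at least `1 / 2`, so a distance below `ε / 2` between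
  -- `q` and `q*` forces `α < ε`.
  refine ⟨ε / 2, by positivity, ?_⟩
  intro Ω' _ P' _ Y' D' Z' U' q ⟨⟨hq, α, h, hα, hh, hnorm, hop, heq⟩, hnear⟩ hne hmodel' hL
  have hα0 : 0 < α := by
    refine lt_of_le_of_ne hα fun h0 => hne fun d u hu => ?_
    rw [heq d u hu, ← h0, zero_smul, add_zero]
  have hhc : ∀ d, ContinuousOn (h d) 𝒰 := fun d => (hh d).1
  have hqc : ∀ d, ContinuousOn (q d) 𝒰 := fun d => (hq.1 d).1
  obtain ⟨d₀, i₀, u₀, hu₀, hlarge⟩ := exists_le_abs_of_lt_normQ (q := h) (c := 1 / 2)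
    (by norm_num) (by rw [hnorm]; norm_num)
  have hαε : α < ε := by
    have h1 := abs_le_normQ hU_compact (q := q - qstar) (fun d => (hqc d).sub (hcont d)) d₀ i₀ hu₀
    have h2 : (q - qstar) d₀ u₀ i₀ = α * h d₀ u₀ i₀ := by
      simp [heq d₀ u₀ hu₀]
    rw [h2, abs_mul, abs_of_pos hα0] at h1
    nlinarith
  have hhder : ∀ d, ∀ u ∈ 𝒰, HasFDerivWithinAt (h d) (derivOn 𝒰 (h d) u) 𝒰 u := fun d u hu =>
    (hh d).hasFDerivWithinAt_derivOn one_le_two hU_convex hclosed hInt hu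
  have hhsymm : ∀ d, ∀ u ∈ 𝒰, ∀ x y, inner ℝ (derivOn 𝒰 (h d) u x) y =
      inner ℝ x (derivOn 𝒰 (h d) u y) := fun d u hu =>
    symm_of_add_smul hα0.ne' (hq.2 d u hu).1.1 (hsymm d u hu)
      (derivOn_add_smul hU_convex hclosed hInt (hq.1 d) (hst.1 d) (hh d) (heq d) hu)
  choose ψ hψ using fun d => exists_potential hU_convex (hhder d) (hhsymm d)
  have htrans : ∀ d, ∃ T : Euc p → Euc p, MapsTo T 𝒰 𝒰 ∧ ContinuousOn T 𝒰 ∧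
      ∀ u ∈ 𝒰, q d (T u) = qstar d u := fun d =>
    -- The instrument value `z = d` is used because `a d d` is positive almost everywhere.
    exists_transport hU_convex (hder hq d) hlo (hbound hq d) (hcont d)
      (hmodel.image_subset_image hmodel' hL hμ0 hU_compact hU_convex hInt (hrank d d) (hac d d)
        (hapos d) (hcont d) (hqc d))
  choose T hTm hTc hT using htrans
  have hZ' : ∀ z, P' (Z' ⁻¹' {z}) ≠ 0 := by
    intro z
    rw [← hmodel'.obsLaw_instrument, hL, hmodel.obsLaw_instrument]
    exact hZ z
  have hsmall := hmain α hα0 hαε h T ψ hψ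
    (fun d x hx y hy => hU_convex.norm_image_sub_le_of_norm_hasFDerivWithin_le (hhder d)
      (fun u hu => (norm_derivOn_le_supOpNorm hU_compact
        ((hh d).continuousOn_derivOn one_le_two hU_convex hInt) hu).trans (hop d)) hy hx)
    (fun d x hx => (norm_le_of_abs_le fun i =>
      (abs_le_normQ hU_compact hhc d i hx).trans hnorm.le).trans (by linarith))
    hTm hTc (fun d u hu => by rw [← heq d _ (hTm d hu), hT d u hu])
    (fun z => hmodel.sum_integral_eq_zero hmodel' hL hμ0 hU_compact (hZ z) (hZ' z) hcont hqc
      (hinj hq) hTm hTc hT (fun d => hrank d z) (fun d => hac d z) (fun d => ha0 d z)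
      (fun u hu => (hψ z u hu).continuousWithinAt)) d₀ u₀ hu₀
  have := PiLp.norm_apply_le (h d₀ u₀) i₀
  rw [Real.norm_eq_abs] at this
  linarith
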